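/- Theorem. A conic in $\mathbb{CP}^2$ is identified with the class, up to non-zero scalars, of a non-zero symmetric $3\times 3$ complex matrix, i.e. with a point of $\mathbb{CP}^5$. Let $\mathfrak{O}\subset\mathbb{CP}^5\times\mathbb{CP}^5$ be the open set of pairs $(C,D)$ of non-degenerate conics that intersect transversely (at every common point their tangent lines are distinct); it is a complex manifold of dimension $10$. The group $G=PGL_3(\mathbb{C})$ acts on $\mathfrak{O}$ by congruence: two pairs $(C,D)$, $(C',D')$ lie in the same orbit if and only if $C'\sim A^TCA$ and $D'\sim A^TDA$ for some $A\in GL_3(\mathbb{C})$, where $\sim$ denotes equality up to a non-zero scalar. Let $\omega=e^{2\pi i/3}$; the orbit of $(I_3,\mathrm{diag}(1,\omega,\omega^2))$ is called the special orbit, and all other orbits are called standard. Let $V_4\subset G$ be the group of classes of the matrices $\mathrm{diag}(\pm1,\pm1,\pm1)$, let $\mathbb{Z}_3\subset G$ be the subgroup generated by the class of the permutation matrix of a $3$-cycle, and let $\Phi:\mathbb{Z}_3\to\mathrm{Aut}(V_4)$ be the action by conjugation, i.e. by cyclic permutation of the diagonal entries. Then $V_4$ is a Klein four-group, $\mathbb{Z}_3$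 has order $3$, and the natural homomorphism $V_4\rtimes_\Phi\mathbb{Z}_3\to G$, $(a,b)\mapsto ab$, is injective, so that $V_4\rtimes_\Phi\mathbb{Z}_3$ is identified with its image, a subgroup of $G$. Equip the quotients of $G$ by these finite subgroups with the complex structures for which the projections from $G$ are local biholomorphisms. Then: 1. Each $G$-orbit in $\mathfrak{O}$ is an embedded connected complex submanifold of $\mathfrak{O}$ of dimension $8$. 2. Each standard orbit is biholomorphic to $G/V_4$. In particular, if $\lambda_1,\lambda_2,\lambda_3$ are distinct non-zero complex numbers and $(\lambda_1,\lambda_2,\lambda_3)$ is not, up to a permutation of its entries, a multiple of $(1,\omega,\omega^2)$, then the orbit of $(I_3,\mathrm{diag}(\lambda_1,\lambda_2,\lambda_3))$ is biholomorphic to $G/V_4$. 3. The special orbit is biholomorphic to $G/(V_4\rtimes_\Phi\mathbb{Z}_3)$. -/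

import Mathlib

open scoped Manifold ContDiff Topology MatrixGroups LinearAlgebra.Projectivization Matrix
open Topology

namespace ConicPairs
noncomputable section

/-- Complex projective space of dimension `n`. -/
abbrev CP (n : ℕ) : Type := ℙ ℂ (Fin (n + 1) → ℂ)

/-- The quotient topology. -/
instance (n : ℕ) : TopologicalSpace (CP n) :=
  inferInstanceAs (TopologicalSpace (Quotient (projectivizationSetoid ℂ (Fin (n + 1) → ℂ))))

theorem isOpenQuotientMap_mk (n : ℕ) :
    IsOpenQuotientMap (Projectivization.mk' ℂ : {v : Fin (n + 1) → ℂ // v ≠ 0} → CP n) where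
  surjective := Quotient.mk_surjective
  continuous := continuous_quot_mk
  isOpenMap := by
    intro U hU
    have key : (Projectivization.mk' ℂ : _ → CP n) ⁻¹' (Projectivization.mk' ℂ '' U)
        = ⋃ t : ℂˣ, (fun v : {v : Fin (n + 1) → ℂ // v ≠ 0} =>
          (⟨t • v.1, (smul_ne_zero_iff_ne t).2 v.2⟩ : {v : Fin (n + 1) → ℂ // v ≠ 0})) ⁻¹' U := by
      ext v
      simp only [Set.mem_preimage, Set.mem_image, Set.mem_iUnion]
      constructor
      · rintro ⟨w, hw, h⟩
        rw [Projectivization.mk'_eq_mk, Projectivization.mk'_eq_mk,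
          Projectivization.mk_eq_mk_iff] at h
        obtain ⟨t, ht⟩ := h
        exact ⟨t, by simpa [ht] using hw⟩
      · rintro ⟨t, ht⟩
        refine ⟨_, ht, ?_⟩
        rw [Projectivization.mk'_eq_mk, Projectivization.mk'_eq_mk,
          Projectivization.mk_eq_mk_iff]
        exact ⟨t, rfl⟩
    change IsOpen ((Projectivization.mk' ℂ : _ → CP n) ⁻¹' (Projectivization.mk' ℂ '' U))
    rw [key]
    refine isOpen_iUnion fun t => hU.preimage ?_
    fun_prop

/-- The points whose `i`-th homogeneous coordinate does not vanish. -/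
def affineSet {n : ℕ} (i : Fin (n + 1)) : Set (CP n) := {p | p.rep i ≠ 0}

theorem exists_rep_mk {n : ℕ} {v : Fin (n + 1) → ℂ} (hv : v ≠ 0) :
    ∃ t : ℂ, t ≠ 0 ∧ (Projectivization.mk ℂ v hv).rep = t • v := by
  obtain ⟨a, ha⟩ := Projectivization.exists_smul_eq_mk_rep ℂ v hv
  exact ⟨a, a.ne_zero, ha.symm⟩

theorem mk_mem_affineSet {n : ℕ} {i : Fin (n + 1)} {v : Fin (n + 1) → ℂ} (hv : v ≠ 0) :
    Projectivization.mk ℂ v hv ∈ affineSet i ↔ v i ≠ 0 := by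
  obtain ⟨t, ht, h⟩ := exists_rep_mk hv
  simp [affineSet, h, ht]

theorem isOpen_affineSet {n : ℕ} (i : Fin (n + 1)) : IsOpen (affineSet i) := by
  rw [← (isOpenQuotientMap_mk n).isQuotientMap.isOpen_preimage]
  have : (Projectivization.mk' ℂ : _ → CP n) ⁻¹' affineSet i = {v | v.1 i ≠ 0} := by
    ext v
    exact mk_mem_affineSet v.2
  rw [this]
  exact isOpen_ne_fun ((continuous_apply i).comp continuous_subtype_val) continuous_const

theorem insertNth_ne_zero {n : ℕ} (i : Fin (n + 1)) (v : Fin n → ℂ) :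
    (i.insertNth (1 : ℂ) v : Fin (n + 1) → ℂ) ≠ 0 := by
  intro h
  simpa using congrFun h i

/-- Affine coordinates `x_j / x_i`, `j ≠ i`, of a point with homogeneous coordinates `x`. -/
def affineCoords {n : ℕ} (i : Fin (n + 1)) : CP n → (Fin n → ℂ) :=
  Projectivization.lift (fun v j => v.1 (i.succAbove j) / v.1 i) (by
    rintro ⟨a, ha⟩ ⟨b, hb⟩ t h
    have ht : t ≠ 0 := by
      rintro rfl
      exact ha (by simpa using h)
    ext j
    simp only at h
    simp [h, mul_div_mul_left _ _ ht])

/-- The standard affine chart of projective space on the set where `x_i ≠ 0`. -/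
def affineChart {n : ℕ} (i : Fin (n + 1)) : OpenPartialHomeomorph (CP n) (Fin n → ℂ) where
  toFun := affineCoords i
  invFun v := Projectivization.mk ℂ (i.insertNth 1 v) (insertNth_ne_zero i v)
  source := affineSet i
  target := Set.univ
  map_source' _ _ := Set.mem_univ _
  map_target' v _ := (mk_mem_affineSet _).2 (by simp)
  left_inv' p hp := by
    induction p using Projectivization.ind with
    | h v hv =>
      rw [mk_mem_affineSet] at hp
      rw [Projectivization.mk_eq_mk_iff']
      refine ⟨(v i)⁻¹, ?_⟩
      ext j
      refine Fin.succAboveCases i ?_ (fun k => ?_) j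
      · simp [hp]
      · simp [affineCoords, div_eq_inv_mul]
  right_inv' v _ := by
    ext j
    simp [affineCoords]
  open_source := isOpen_affineSet i
  open_target := isOpen_univ
  continuousOn_toFun := by
    rw [(isOpenQuotientMap_mk n).isQuotientMap.continuousOn_isOpen_iff (isOpen_affineSet i)]
    refine continuousOn_pi.2 fun j => ContinuousOn.div
      ((continuous_apply _).comp continuous_subtype_val).continuousOn
      ((continuous_apply _).comp continuous_subtype_val).continuousOn ?_
    exact fun v hv => (mk_mem_affineSet v.2).1 hv
  continuousOn_invFun := by
    refine Continuous.continuousOn ?_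
    exact (isOpenQuotientMap_mk n).continuous.comp
      (Continuous.subtype_mk (f := fun v : Fin n → ℂ => (i.insertNth (1 : ℂ) v : Fin (n + 1) → ℂ))
        (continuous_const.finInsertNth i continuous_id) (insertNth_ne_zero i))

theorem exists_mem_affineSet {n : ℕ} (p : CP n) : ∃ i, p ∈ affineSet i := by
  by_contra! h
  exact p.rep_nonzero (funext fun i => by simpa [affineSet] using h i)

/-- Projective space with its `n + 1` standard affine charts. -/
instance (n : ℕ) : ChartedSpace (Fin n → ℂ) (CP n) where
  atlas := Set.range affineChart
  chartAt p := affineChart (exists_mem_affineSet p).choose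
  mem_chart_source p := (exists_mem_affineSet p).choose_spec
  chart_mem_atlas _ := Set.mem_range_self _

/-- Linear maps read in affine charts are holomorphic. -/
theorem contDiffAt_linear {n : ℕ} (T : (Fin (n + 1) → ℂ) →ₗ[ℂ] (Fin (n + 1) → ℂ))
    (i j : Fin (n + 1)) (v : Fin n → ℂ) (hv : T (i.insertNth 1 v) j ≠ 0) :
    ContDiffAt ℂ ω (fun (w : Fin n → ℂ) (k : Fin n) =>
      T (i.insertNth (1 : ℂ) w) (j.succAbove k) / T (i.insertNth (1 : ℂ) w) j) v := by
  have h1 : ContDiff ℂ ω (fun w : Fin n → ℂ => (i.insertNth (1 : ℂ) w : Fin (n + 1) → ℂ)) := by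
    refine contDiff_pi.2 fun l => ?_
    refine Fin.succAboveCases i ?_ (fun k => ?_) l
    · simpa using contDiff_const
    · simpa using contDiff_apply ℂ ℂ k
  have h2 : ContDiff ℂ ω (fun w : Fin n → ℂ => T (i.insertNth (1 : ℂ) w)) :=
    (LinearMap.toContinuousLinearMap T).contDiff.comp h1
  have h3 := contDiff_pi.1 h2
  exact contDiffAt_pi.2 fun k => (h3 _).contDiffAt.div (h3 _).contDiffAt hv

theorem affineChart_mk {n : ℕ} (i : Fin (n + 1)) {v : Fin (n + 1) → ℂ} (hv : v ≠ 0) :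
    affineChart i (Projectivization.mk ℂ v hv) = fun k => v (i.succAbove k) / v i := rfl

theorem affineChart_symm {n : ℕ} (i : Fin (n + 1)) (v : Fin n → ℂ) :
    (affineChart i).symm v = Projectivization.mk ℂ (i.insertNth 1 v) (insertNth_ne_zero i v) := rfl

theorem affineChart_source {n : ℕ} (i : Fin (n + 1)) :
    (affineChart i).source = affineSet i := rfl

theorem affineChart_target {n : ℕ} (i : Fin (n + 1)) :
    (affineChart i).target = Set.univ := rfl

/-- Projective space is a complex manifold. -/
instance (n : ℕ) : IsManifold 𝓘(ℂ, Fin n → ℂ) ω (CP n) := by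
  refine isManifold_of_contDiffOn _ _ _ ?_
  rintro _ _ ⟨i, rfl⟩ ⟨j, rfl⟩ v hv
  refine ContDiffAt.contDiffWithinAt ?_
  have := contDiffAt_linear LinearMap.id i j v (by
    simpa [affineChart_source, affineChart_target, affineChart_symm, mk_mem_affineSet] using hv)
  exact this

/-- The charted space structure on `X` for which an open embedding `f : X → Y` is a local
isomorphism. -/
@[reducible] def pullbackChartedSpace {H X Y : Type*} [TopologicalSpace H] [TopologicalSpace X]
    [TopologicalSpace Y] [ChartedSpace H Y] [Nonempty X] {f : X → Y} (hf : IsOpenEmbedding f) :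
    ChartedSpace H X where
  atlas := (fun e => (hf.toOpenPartialHomeomorph f).trans e) '' atlas H Y
  chartAt x := (hf.toOpenPartialHomeomorph f).trans (chartAt H (f x))
  mem_chart_source x := by simp
  chart_mem_atlas x := ⟨_, chart_mem_atlas H (f x), rfl⟩

instance : TopologicalSpace PGL(3, ℂ) :=
  inferInstanceAs (TopologicalSpace (GL (Fin 3) ℂ ⧸ Subgroup.center (GL (Fin 3) ℂ)))

instance : IsTopologicalGroup PGL(3, ℂ) :=
  inferInstanceAs (IsTopologicalGroup (GL (Fin 3) ℂ ⧸ Subgroup.center (GL (Fin 3) ℂ)))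

instance : T3Space PGL(3, ℂ) := by
  have : IsClosed (Subgroup.center (GL (Fin 3) ℂ) : Set (GL (Fin 3) ℂ)) := by
    rw [← Subgroup.centralizer_univ]
    exact Set.isClosed_centralizer _
  exact inferInstanceAs (T3Space (GL (Fin 3) ℂ ⧸ Subgroup.center (GL (Fin 3) ℂ)))

/-- The nine entries of a `3 × 3` matrix, as homogeneous coordinates. -/
def entries : Matrix (Fin 3) (Fin 3) ℂ ≃ₗ[ℂ] (Fin (8 + 1) → ℂ) :=
  (LinearEquiv.curry ℂ ℂ (Fin 3) (Fin 3)).symm ≪≫ₗ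
    LinearEquiv.funCongrLeft ℂ ℂ (finProdFinEquiv (m := 3) (n := 3)).symm

theorem entries_ne_zero (A : GL (Fin 3) ℂ) : entries A.1 ≠ 0 := by
  rw [Ne, LinearEquiv.map_eq_zero_iff]
  exact A.ne_zero

/-- The inclusion of `PGL(3, ℂ)` into the projective space of `3 × 3` matrices. -/
def pglToCP : PGL(3, ℂ) → CP 8 :=
  Quotient.lift (fun A : GL (Fin 3) ℂ => Projectivization.mk ℂ (entries A.1) (entries_ne_zero A))
    (by
      intro A B h
      have h' : Matrix.ProjGenLinGroup.mk A = Matrix.ProjGenLinGroup.mk B := Quotient.sound h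
      rw [Matrix.ProjGenLinGroup.mk_eq_mk_iff] at h'
      obtain ⟨u, rfl⟩ := h'
      rw [Projectivization.mk_eq_mk_iff']
      refine ⟨(u : ℂ)⁻¹, ?_⟩
      rw [← map_smul]
      congr 1
      ext a b
      simp [mul_comm (A.1 a b)])

theorem pglToCP_mk (A : GL (Fin 3) ℂ) : pglToCP (Matrix.ProjGenLinGroup.mk A) =
    Projectivization.mk ℂ (entries A.1) (entries_ne_zero A) := rfl

theorem isOpenEmbedding_pglToCP : IsOpenEmbedding pglToCP := by
  have hq : IsQuotientMap (Matrix.ProjGenLinGroup.mk : GL (Fin 3) ℂ → PGL(3, ℂ)) :=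
    isQuotientMap_quotient_mk'
  have hc : Continuous (fun A : GL (Fin 3) ℂ => entries A.1) :=
    (LinearMap.continuous_of_finiteDimensional entries.toLinearMap).comp Units.continuous_val
  have hcomp : pglToCP ∘ Matrix.ProjGenLinGroup.mk = Projectivization.mk' ℂ ∘
      (fun A : GL (Fin 3) ℂ => (⟨entries A.1, entries_ne_zero A⟩ :
        {v : Fin (8 + 1) → ℂ // v ≠ 0})) := rfl
  refine .of_continuous_injective_isOpenMap ?_ ?_ ?_
  · rw [hq.continuous_iff, hcomp]
    exact (isOpenQuotientMap_mk 8).continuous.comp (hc.subtype_mk _)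
  · intro a b
    induction a using Matrix.ProjGenLinGroup.induction_on with | mk A => ?_
    induction b using Matrix.ProjGenLinGroup.induction_on with | mk B => ?_
    rw [pglToCP_mk, pglToCP_mk, Projectivization.mk_eq_mk_iff,
      eq_comm (a := Matrix.ProjGenLinGroup.mk A), Matrix.ProjGenLinGroup.mk_eq_mk_iff]
    rintro ⟨u, hu⟩
    have hu' : entries ((u : ℂ) • B.1) = entries A.1 := by rw [map_smul]; exact hu
    have hu2 := entries.injective hu'
    refine ⟨u, ?_⟩
    ext a b
    simp [← hu2, mul_comm]
  · intro U hU
    have : pglToCP '' U = (pglToCP ∘ Matrix.ProjGenLinGroup.mk) '' (Matrix.ProjGenLinGroup.mk ⁻¹' U) := by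
      rw [Set.image_comp, Set.image_preimage_eq _ Matrix.ProjGenLinGroup.mk_surjective]
    rw [this, hcomp, Set.image_comp]
    refine (isOpenQuotientMap_mk 8).isOpenMap _ ?_
    have hO : IsOpen (Matrix.ProjGenLinGroup.mk ⁻¹' U : Set (GL (Fin 3) ℂ)) := hU.preimage hq.continuous
    have h1 : IsOpenMap (Units.val : GL (Fin 3) ℂ → Matrix (Fin 3) (Fin 3) ℂ) := by
      let _ : NormedRing (Matrix (Fin 3) (Fin 3) ℂ) := Matrix.linftyOpNormedRing
      let _ : NormedAlgebra ℂ (Matrix (Fin 3) (Fin 3) ℂ) := Matrix.linftyOpNormedAlgebra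
      exact Units.isOpenEmbedding_val.isOpenMap
    have h2 := entries.toContinuousLinearEquiv.toHomeomorph.isOpenMap _ (h1 _ hO)
    convert h2.preimage continuous_subtype_val using 1
    ext v
    simp only [Set.mem_image, Set.mem_preimage]
    constructor
    · rintro ⟨A, hA, rfl⟩
      exact ⟨A.1, ⟨A, hA, rfl⟩, rfl⟩
    · rintro ⟨_, ⟨A, hA, rfl⟩, h⟩
      exact ⟨A, hA, Subtype.ext h⟩

/-- `PGL(3, ℂ)` as a complex manifold: an open subset of the projective space of `3 × 3`
matrices. -/
instance : ChartedSpace (Fin 8 → ℂ) PGL(3, ℂ) := pullbackChartedSpace isOpenEmbedding_pglToCP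

/-- Right multiplication by `A` on `3 × 3` matrices. -/
def rightMul (A : GL (Fin 3) ℂ) : (Fin (8 + 1) → ℂ) →ₗ[ℂ] (Fin (8 + 1) → ℂ) :=
  entries.toLinearMap ∘ₗ LinearMap.mulRight ℂ A.1 ∘ₗ entries.symm.toLinearMap

theorem pglToCP_mul {q : PGL(3, ℂ)} {x : Fin (8 + 1) → ℂ} (hx : x ≠ 0)
    (h : pglToCP q = Projectivization.mk ℂ x hx) (A : GL (Fin 3) ℂ) :
    ∃ hx' : rightMul A x ≠ 0,
      pglToCP (q * Matrix.ProjGenLinGroup.mk A) = Projectivization.mk ℂ (rightMul A x) hx' := by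
  induction q using Matrix.ProjGenLinGroup.induction_on with | mk B => ?_
  rw [pglToCP_mk, Projectivization.mk_eq_mk_iff] at h
  obtain ⟨u, hu⟩ := h
  have key : entries (B * A : GL (Fin 3) ℂ).1 = u • rightMul A x := by
    have : entries.symm (u • x) = B.1 := by rw [hu, LinearEquiv.symm_apply_apply]
    have h2 : rightMul A (u • x) = entries (B.1 * A.1) := by
      simp only [rightMul, LinearMap.comp_apply, LinearEquiv.coe_coe, this]
      rfl
    rw [Units.val_mul, ← h2]
    exact map_smul (rightMul A) (u : ℂ) x
  have hne : rightMul A x ≠ 0 := fun h0 => entries_ne_zero (B * A) (by rw [key, h0, smul_zero])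
  refine ⟨hne, ?_⟩
  rw [← map_mul, pglToCP_mk, Projectivization.mk_eq_mk_iff]
  exact ⟨u, key.symm⟩

theorem contDiffAt_pgl_mul {e e' : OpenPartialHomeomorph PGL(3, ℂ) (Fin 8 → ℂ)}
    (he : e ∈ atlas (Fin 8 → ℂ) PGL(3, ℂ)) (he' : e' ∈ atlas (Fin 8 → ℂ) PGL(3, ℂ))
    (g : PGL(3, ℂ)) {v : Fin 8 → ℂ} (hv : v ∈ e.target) (hv' : e.symm v * g ∈ e'.source) :
    ContDiffAt ℂ ω (fun w => e' (e.symm w * g)) v := by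
  obtain ⟨_, ⟨i, rfl⟩, rfl⟩ := he
  obtain ⟨_, ⟨j, rfl⟩, rfl⟩ := he'
  induction g using Matrix.ProjGenLinGroup.induction_on with | mk A => ?_
  set F := isOpenEmbedding_pglToCP.toOpenPartialHomeomorph pglToCP with hF
  have key : ∀ w ∈ (F.trans (affineChart i)).target,
      ∃ hx' : rightMul A (i.insertNth (1 : ℂ) w) ≠ 0,
        pglToCP ((F.trans (affineChart i)).symm w * Matrix.ProjGenLinGroup.mk A) =
          Projectivization.mk ℂ (rightMul A (i.insertNth (1 : ℂ) w)) hx' := by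
    intro w hw
    refine pglToCP_mul (insertNth_ne_zero i w) ?_ A
    have hw' : (affineChart i).symm w ∈ F.target := by
      simpa [affineChart_target] using hw
    exact F.right_inv hw'
  have hev : (fun w => (F.trans (affineChart j))
      ((F.trans (affineChart i)).symm w * Matrix.ProjGenLinGroup.mk A)) =ᶠ[𝓝 v]
      fun w k => rightMul A (i.insertNth (1 : ℂ) w) (j.succAbove k) /
        rightMul A (i.insertNth (1 : ℂ) w) j := by
    filter_upwards [(F.trans (affineChart i)).open_target.mem_nhds hv] with w hw
    obtain ⟨hx', h⟩ := key w hw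
    change affineChart j (pglToCP _) = _
    rw [h, affineChart_mk]
  refine ContDiffAt.congr_of_eventuallyEq (contDiffAt_linear (rightMul A) i j v ?_) hev
  obtain ⟨hx', h⟩ := key v hv
  have h3 : pglToCP ((F.trans (affineChart i)).symm v * Matrix.ProjGenLinGroup.mk A) ∈
      affineSet j := by
    have := hv'
    simp only [OpenPartialHomeomorph.trans_source] at this
    exact this.2
  rw [h, mk_mem_affineSet] at h3
  exact h3

instance : IsManifold 𝓘(ℂ, Fin 8 → ℂ) ω PGL(3, ℂ) := by
  refine isManifold_of_contDiffOn _ _ _ ?_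
  intro e e' he he' v hv
  refine ContDiffAt.contDiffWithinAt ?_
  simp only [modelWithCornersSelf_coe, modelWithCornersSelf_coe_symm, Set.preimage_id,
    Set.range_id, Set.inter_univ, OpenPartialHomeomorph.trans_source,
    OpenPartialHomeomorph.symm_source, Set.mem_inter_iff, Set.mem_preimage] at hv
  have := contDiffAt_pgl_mul he he' 1 hv.1 (by simpa using hv.2)
  simp only [mul_one] at this
  exact this

theorem isQuotientCoveringMap_pgl (K : Subgroup PGL(3, ℂ)) [Finite K] :
    IsQuotientCoveringMap (QuotientGroup.mk : PGL(3, ℂ) → PGL(3, ℂ) ⧸ K) K.op :=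
  K.isQuotientCoveringMap (Set.toFinite (K : Set PGL(3, ℂ))).isDiscrete

/-- The quotient of `PGL(3, ℂ)` by a finite subgroup, with the complex structure pushed forward
along the covering `PGL(3, ℂ) → PGL(3, ℂ) ⧸ K`. -/
instance (K : Subgroup PGL(3, ℂ)) [Finite K] : ChartedSpace (Fin 8 → ℂ) (PGL(3, ℂ) ⧸ K) :=
  (isQuotientCoveringMap_pgl K).isCoveringMap.isLocalHomeomorph.chartedSpace
    (QuotientGroup.mk_surjective)

instance (K : Subgroup PGL(3, ℂ)) [Finite K] :
    IsManifold 𝓘(ℂ, Fin 8 → ℂ) ω (PGL(3, ℂ) ⧸ K) := by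
  refine isManifold_of_contDiffOn _ _ _ ?_
  have hloc := (isQuotientCoveringMap_pgl K).isCoveringMap.isLocalHomeomorph
  rintro _ _ ⟨q, rfl⟩ ⟨q', rfl⟩ v hv
  refine ContDiffAt.contDiffWithinAt ?_
  set s := hloc.localInverseAt ((QuotientGroup.mk_surjective (s := K)).hasRightInverse.choose q)
    with hs
  set s' := hloc.localInverseAt ((QuotientGroup.mk_surjective (s := K)).hasRightInverse.choose q')
    with hs'
  set e := chartAt (Fin 8 → ℂ) ((QuotientGroup.mk_surjective (s := K)).hasRightInverse.choose q)
    with he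
  set e' := chartAt (Fin 8 → ℂ) ((QuotientGroup.mk_surjective (s := K)).hasRightInverse.choose q')
    with he'
  have hsm : ∀ x, s.symm x = QuotientGroup.mk x := fun x => by
    rw [hs, IsLocalHomeomorph.localInverseAt_symm]
  have hsm' : ∀ y ∈ s'.source, QuotientGroup.mk (s' y) = y := fun y hy =>
    hloc.apply_localInverseAt_of_mem hy
  have hsrc : v ∈ ((s.trans e).symm.trans (s'.trans e')).source := by simpa using hv
  set U := ((s.trans e).symm.trans (s'.trans e')).source with hU
  have hUo : IsOpen U := ((s.trans e).symm.trans (s'.trans e')).open_source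
  have hmem : ∀ w ∈ U, w ∈ e.target ∧ (QuotientGroup.mk (e.symm w) : PGL(3, ℂ) ⧸ K) ∈ s'.source ∧
      s' (QuotientGroup.mk (e.symm w)) ∈ e'.source := by
    intro w hw
    simp only [hU, OpenPartialHomeomorph.trans_source, OpenPartialHomeomorph.symm_source,
      Set.mem_inter_iff, Set.mem_preimage,
      OpenPartialHomeomorph.trans_symm_eq_symm_trans_symm, OpenPartialHomeomorph.coe_trans,
      Function.comp_apply, hsm] at hw
    exact ⟨hw.1.1, hw.2.1, hw.2.2⟩
  -- the two local sections differ by a locally constant element of `K`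
  let h : (Fin 8 → ℂ) → PGL(3, ℂ) := fun w =>
    (e.symm w)⁻¹ * s' (QuotientGroup.mk (e.symm w))
  have hK : ∀ w ∈ U, h w ∈ K := fun w hw => by
    rw [← QuotientGroup.eq]
    exact (hsm' _ (hmem w hw).2.1).symm
  have hcont : ContinuousOn h U := by
    have h1 : ContinuousOn e.symm U := e.continuousOn_symm.mono fun w hw => (hmem w hw).1
    refine h1.inv.mul (s'.continuousOn.comp ?_ fun w hw => (hmem w hw).2.1)
    exact (isQuotientCoveringMap_pgl K).continuous.comp_continuousOn h1
  have hconst : ∀ᶠ w in 𝓝 v, h w = h v := by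
    have hfin : ((K : Set PGL(3, ℂ)) \ {h v}).Finite := (Set.toFinite (K : Set PGL(3, ℂ))).sdiff
    have hn : ((K : Set PGL(3, ℂ)) \ {h v})ᶜ ∈ 𝓝 (h v) :=
      hfin.isClosed.isOpen_compl.mem_nhds (by simp)
    filter_upwards [hUo.mem_nhds hsrc,
      (hcont.continuousAt (hUo.mem_nhds hsrc)).preimage_mem_nhds hn] with w hw hw'
    by_contra hne
    exact hw' ⟨hK w hw, hne⟩
  have hfin := contDiffAt_pgl_mul (e := e) (e' := e') (chart_mem_atlas _ _) (chart_mem_atlas _ _)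
    (h v) (hmem v hsrc).1 (by simpa only [h, mul_inv_cancel_left] using (hmem v hsrc).2.2)
  refine hfin.congr_of_eventuallyEq ?_
  filter_upwards [hconst] with w hw
  have hw1 : e.symm w * h v = s' (QuotientGroup.mk (e.symm w)) := by
    rw [← hw]
    simp only [h, mul_inv_cancel_left]
  rw [hw1, ← hsm]
  rfl

/-- The symmetric matrix of the conic with homogeneous coordinates `[x₀ : ⋯ : x₅]`. -/
def conicMatrix : (Fin (5 + 1) → ℂ) →ₗ[ℂ] Matrix (Fin 3) (Fin 3) ℂ where
  toFun x := !![x 0, x 1, x 2; x 1, x 3, x 4; x 2, x 4, x 5]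
  map_add' x y := by ext i j; fin_cases i <;> fin_cases j <;> rfl
  map_smul' t x := by ext i j; fin_cases i <;> fin_cases j <;> rfl

/-- The homogeneous coordinates of a symmetric matrix. -/
def conicCoords : Matrix (Fin 3) (Fin 3) ℂ →ₗ[ℂ] (Fin (5 + 1) → ℂ) where
  toFun M := ![M 0 0, M 0 1, M 0 2, M 1 1, M 1 2, M 2 2]
  map_add' x y := by ext i; fin_cases i <;> rfl
  map_smul' t x := by ext i; fin_cases i <;> rfl

theorem conicMatrix_transpose (x : Fin (5 + 1) → ℂ) : (conicMatrix x)ᵀ = conicMatrix x := by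
  ext i j; fin_cases i <;> fin_cases j <;> rfl

theorem conicCoords_conicMatrix (x : Fin (5 + 1) → ℂ) : conicCoords (conicMatrix x) = x := by
  ext i; fin_cases i <;> rfl

theorem conicMatrix_conicCoords {M : Matrix (Fin 3) (Fin 3) ℂ} (h : Mᵀ = M) :
    conicMatrix (conicCoords M) = M := by
  have h' : ∀ i j, M j i = M i j := fun i j => congrFun (congrFun h i) j
  ext i j
  fin_cases i <;> fin_cases j <;> first | rfl | exact h' _ _

/-- The conic is non-degenerate. -/
def IsNondegenerate (c : CP 5) : Prop := (conicMatrix c.rep).det ≠ 0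

/-- The point `p` of the projective plane lies on the conic `c`. -/
def OnConic (p : CP 2) (c : CP 5) : Prop := p.rep ⬝ᵥ conicMatrix c.rep *ᵥ p.rep = 0

/-- The coefficients of the tangent line to the conic `c` at the point `p`. -/
def tangentLine (p : CP 2) (c : CP 5) : Fin 3 → ℂ := conicMatrix c.rep *ᵥ p.rep

/-- The two conics meet transversely: at each common point their tangent lines are distinct. -/
def IsTransverse (c d : CP 5) : Prop :=
  ∀ p : CP 2, OnConic p c → OnConic p d →
    LinearIndependent ℂ ![tangentLine p c, tangentLine p d]

theorem isNondegenerate_mk {x : Fin (5 + 1) → ℂ} (hx : x ≠ 0) :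
    IsNondegenerate (Projectivization.mk ℂ x hx) ↔ (conicMatrix x).det ≠ 0 := by
  obtain ⟨t, ht, h⟩ := exists_rep_mk hx
  simp [IsNondegenerate, h, ht]

theorem onConic_mk {v : Fin (2 + 1) → ℂ} (hv : v ≠ 0) {x : Fin (5 + 1) → ℂ} (hx : x ≠ 0) :
    OnConic (Projectivization.mk ℂ v hv) (Projectivization.mk ℂ x hx) ↔
      v ⬝ᵥ conicMatrix x *ᵥ v = 0 := by
  obtain ⟨t, ht, h⟩ := exists_rep_mk hx
  obtain ⟨s, hs, h'⟩ := exists_rep_mk hv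
  simp [OnConic, h, h', ht, hs, Matrix.smul_mulVec, Matrix.mulVec_smul]

theorem tangentLine_mk {v : Fin (2 + 1) → ℂ} (hv : v ≠ 0) {x : Fin (5 + 1) → ℂ} (hx : x ≠ 0) :
    ∃ t : ℂˣ, tangentLine (Projectivization.mk ℂ v hv) (Projectivization.mk ℂ x hx) =
      t • conicMatrix x *ᵥ v := by
  obtain ⟨t, ht, h⟩ := exists_rep_mk hx
  obtain ⟨s, hs, h'⟩ := exists_rep_mk hv
  refine ⟨Units.mk0 (t * s) (mul_ne_zero ht hs), ?_⟩
  simp [tangentLine, h, h', Matrix.smul_mulVec, Matrix.mulVec_smul, smul_smul, Units.smul_def,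
    mul_comm]

theorem linearIndependent_tangentLine_mk {v : Fin (2 + 1) → ℂ} (hv : v ≠ 0)
    {x y : Fin (5 + 1) → ℂ} (hx : x ≠ 0) (hy : y ≠ 0) :
    LinearIndependent ℂ ![tangentLine (Projectivization.mk ℂ v hv) (Projectivization.mk ℂ x hx),
      tangentLine (Projectivization.mk ℂ v hv) (Projectivization.mk ℂ y hy)] ↔
    LinearIndependent ℂ ![conicMatrix x *ᵥ v, conicMatrix y *ᵥ v] := by
  obtain ⟨t, ht⟩ := tangentLine_mk hv hx
  obtain ⟨s, hs⟩ := tangentLine_mk hv hy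
  have : ![tangentLine (Projectivization.mk ℂ v hv) (Projectivization.mk ℂ x hx),
      tangentLine (Projectivization.mk ℂ v hv) (Projectivization.mk ℂ y hy)] =
      ![t, s] • ![conicMatrix x *ᵥ v, conicMatrix y *ᵥ v] := by
    ext i : 1
    fin_cases i
    · exact ht
    · exact hs
  rw [this]
  exact LinearIndependent.units_smul_iff _ _

theorem isTransverse_mk {x y : Fin (5 + 1) → ℂ} (hx : x ≠ 0) (hy : y ≠ 0) :
    IsTransverse (Projectivization.mk ℂ x hx) (Projectivization.mk ℂ y hy) ↔
      ∀ v : Fin 3 → ℂ, v ≠ 0 → v ⬝ᵥ conicMatrix x *ᵥ v = 0 → v ⬝ᵥ conicMatrix y *ᵥ v = 0 →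
        LinearIndependent ℂ ![conicMatrix x *ᵥ v, conicMatrix y *ᵥ v] := by
  constructor
  · intro h v hv h1 h2
    rw [← linearIndependent_tangentLine_mk hv hx hy]
    exact h _ ((onConic_mk hv hx).2 h1) ((onConic_mk hv hy).2 h2)
  · intro h p
    induction p using Projectivization.ind with
    | h v hv =>
      rw [onConic_mk hv, onConic_mk hv, linearIndependent_tangentLine_mk]
      exact h v hv

instance (n : ℕ) : CompactSpace (CP n) := by
  have h0 : ∀ v : Metric.sphere (0 : Fin (n + 1) → ℂ) 1, v.1 ≠ 0 := fun v h => by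
    have := v.2
    simp [h] at this
  refine Function.Surjective.compactSpace
    (f := fun v : Metric.sphere (0 : Fin (n + 1) → ℂ) 1 => Projectivization.mk ℂ v.1 (h0 v)) ?_ ?_
  · exact (isOpenQuotientMap_mk n).continuous.comp (continuous_subtype_val.subtype_mk h0)
  · intro p
    induction p using Projectivization.ind with
    | h v hv =>
      refine ⟨⟨(‖v‖⁻¹ : ℂ) • v, by simp [norm_smul, hv]⟩, ?_⟩
      rw [Projectivization.mk_eq_mk_iff']
      exact ⟨_, rfl⟩

theorem isOpen_isNondegenerate : IsOpen {c : CP 5 | IsNondegenerate c} := by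
  rw [← (isOpenQuotientMap_mk 5).isQuotientMap.isOpen_preimage]
  have : (Projectivization.mk' ℂ : _ → CP 5) ⁻¹' {c | IsNondegenerate c} =
      {x | (conicMatrix x.1).det ≠ 0} := by
    ext x
    exact isNondegenerate_mk x.2
  rw [this]
  have hc : Continuous conicMatrix := LinearMap.continuous_of_finiteDimensional _
  exact isOpen_ne_fun (hc.comp continuous_subtype_val).matrix_det continuous_const

theorem isOpen_isTransverse : IsOpen {c : CP 5 × CP 5 | IsTransverse c.1 c.2} := by
  let Z : Set (CP 2 × (CP 5 × CP 5)) := {z | OnConic z.1 z.2.1 ∧ OnConic z.1 z.2.2 ∧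
    ¬ LinearIndependent ℂ ![tangentLine z.1 z.2.1, tangentLine z.1 z.2.2]}
  have hZ : IsClosed Z := by
    have hq := ((isOpenQuotientMap_mk 2).prodMap
      ((isOpenQuotientMap_mk 5).prodMap (isOpenQuotientMap_mk 5))).isQuotientMap
    rw [← hq.isClosed_preimage]
    have : (Prod.map (Projectivization.mk' ℂ) (Prod.map (Projectivization.mk' ℂ)
        (Projectivization.mk' ℂ)) : _ → CP 2 × (CP 5 × CP 5)) ⁻¹' Z =
        {z | z.1.1 ⬝ᵥ conicMatrix z.2.1.1 *ᵥ z.1.1 = 0} ∩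
        {z | z.1.1 ⬝ᵥ conicMatrix z.2.2.1 *ᵥ z.1.1 = 0} ∩
        {z | crossProduct (conicMatrix z.2.1.1 *ᵥ z.1.1) (conicMatrix z.2.2.1 *ᵥ z.1.1) = 0} := by
      ext ⟨⟨v, hv⟩, ⟨x, hx⟩, ⟨y, hy⟩⟩
      have h3 := not_congr (linearIndependent_tangentLine_mk hv hx hy)
      rw [← crossProduct_ne_zero_iff_linearIndependent (v := conicMatrix x *ᵥ v),
        not_not] at h3
      have h1 := onConic_mk hv hx
      have h2 := onConic_mk hv hy
      simp only [Set.mem_preimage, Z, Set.mem_ofPred_eq, Set.mem_inter_iff, Prod.map_apply,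
        Projectivization.mk'_eq_mk, and_assoc]
      rw [h1, h2, h3]
    rw [this]
    have hc : Continuous conicMatrix := LinearMap.continuous_of_finiteDimensional _
    have hv : Continuous fun z : {v : Fin (2 + 1) → ℂ // v ≠ 0} × {v : Fin (5 + 1) → ℂ // v ≠ 0} ×
      {v : Fin (5 + 1) → ℂ // v ≠ 0} => z.1.1 := continuous_subtype_val.comp continuous_fst
    have hx : Continuous fun z : {v : Fin (2 + 1) → ℂ // v ≠ 0} × {v : Fin (5 + 1) → ℂ // v ≠ 0} ×
      {v : Fin (5 + 1) → ℂ // v ≠ 0} => conicMatrix z.2.1.1 *ᵥ z.1.1 :=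
      (hc.comp (continuous_subtype_val.comp (continuous_fst.comp continuous_snd))).matrix_mulVec hv
    have hy : Continuous fun z : {v : Fin (2 + 1) → ℂ // v ≠ 0} × {v : Fin (5 + 1) → ℂ // v ≠ 0} ×
      {v : Fin (5 + 1) → ℂ // v ≠ 0} => conicMatrix z.2.2.1 *ᵥ z.1.1 :=
      (hc.comp (continuous_subtype_val.comp (continuous_snd.comp continuous_snd))).matrix_mulVec hv
    refine ((isClosed_eq (hv.dotProduct hx) continuous_const).inter
      (isClosed_eq (hv.dotProduct hy) continuous_const)).inter (isClosed_eq ?_ continuous_const)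
    have hx' := fun i => (continuous_apply i).comp hx
    have hy' := fun i => (continuous_apply i).comp hy
    simp only [cross_apply]
    refine continuous_pi fun i => ?_
    fin_cases i
    · exact ((hx' 1).mul (hy' 2)).sub ((hx' 2).mul (hy' 1))
    · exact ((hx' 2).mul (hy' 0)).sub ((hx' 0).mul (hy' 2))
    · exact ((hx' 0).mul (hy' 1)).sub ((hx' 1).mul (hy' 0))
  have himg := (isClosedMap_snd_of_compactSpace (X := CP 2) (Y := CP 5 × CP 5)) Z hZ
  have : {c : CP 5 × CP 5 | IsTransverse c.1 c.2} = (Prod.snd '' Z)ᶜ := by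
    ext c
    simp [IsTransverse, Z]
  rw [this]
  exact himg.isOpen_compl

/-- The open set of pairs of non-degenerate conics that intersect transversely. -/
def pairs : TopologicalSpace.Opens (CP 5 × CP 5) where
  carrier := {c | IsNondegenerate c.1 ∧ IsNondegenerate c.2 ∧ IsTransverse c.1 c.2}
  is_open' := (isOpen_isNondegenerate.preimage continuous_fst).inter
    ((isOpen_isNondegenerate.preimage continuous_snd).inter isOpen_isTransverse)

/-- The effect of `g` on coordinates of conics, `M ↦ (g⁻¹)ᵀ M g⁻¹`: a point `p` lies on a conic
if and only if `g p` lies on the transformed conic. -/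
def transform (g : GL (Fin 3) ℂ) : (Fin (5 + 1) → ℂ) →ₗ[ℂ] (Fin (5 + 1) → ℂ) :=
  conicCoords ∘ₗ LinearMap.mulLeft ℂ (g⁻¹.1ᵀ) ∘ₗ LinearMap.mulRight ℂ g⁻¹.1 ∘ₗ conicMatrix

theorem conicMatrix_transform (g : GL (Fin 3) ℂ) (x : Fin (5 + 1) → ℂ) :
    conicMatrix (transform g x) = g⁻¹.1ᵀ * conicMatrix x * g⁻¹.1 := by
  have : transform g x = conicCoords (g⁻¹.1ᵀ * (conicMatrix x * g⁻¹.1)) := rfl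
  rw [this, conicMatrix_conicCoords, mul_assoc]
  simp [Matrix.transpose_mul, conicMatrix_transpose, mul_assoc]

theorem conicMatrix_injective : Function.Injective conicMatrix :=
  Function.LeftInverse.injective conicCoords_conicMatrix

theorem transform_one (x : Fin (5 + 1) → ℂ) : transform 1 x = x :=
  conicMatrix_injective (by simp [conicMatrix_transform])

theorem transform_mul (g h : GL (Fin 3) ℂ) (x : Fin (5 + 1) → ℂ) :
    transform (g * h) x = transform g (transform h x) :=
  conicMatrix_injective (by
    simp only [conicMatrix_transform, mul_inv_rev, Units.val_mul, Matrix.transpose_mul, mul_assoc])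

theorem transform_scalar (u : ℂˣ) (x : Fin (5 + 1) → ℂ) :
    transform (Matrix.GeneralLinearGroup.scalar (Fin 3) u) x = (u⁻¹ * u⁻¹) • x :=
  conicMatrix_injective (by
    have h : ((Matrix.GeneralLinearGroup.scalar (Fin 3) u)⁻¹).1 = Matrix.scalar (Fin 3) (u⁻¹).1 := by
      rw [← map_inv, Matrix.GeneralLinearGroup.coe_scalar]
    rw [conicMatrix_transform, h, Units.smul_def, map_smul, Matrix.scalar_apply,
      Matrix.diagonal_transpose]
    ext i j
    rw [Matrix.mul_diagonal, Matrix.diagonal_mul, Matrix.smul_apply, smul_eq_mul, Units.val_mul]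
    ring)

theorem transform_injective (g : GL (Fin 3) ℂ) : Function.Injective (transform g) :=
  Function.LeftInverse.injective (g := transform g⁻¹) fun x => by
    rw [← transform_mul, inv_mul_cancel, transform_one]

/-- The transform of a conic by a projective transformation. -/
def transformConic (g : GL (Fin 3) ℂ) : CP 5 → CP 5 :=
  Projectivization.map (transform g) (transform_injective g)

theorem transformConic_mk (g : GL (Fin 3) ℂ) {x : Fin (5 + 1) → ℂ} (hx : x ≠ 0) :
    transformConic g (Projectivization.mk ℂ x hx) = Projectivization.mk ℂ (transform g x)
      ((map_ne_zero_iff _ (transform_injective g)).2 hx) := rfl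

theorem transformConic_mem (g : GL (Fin 3) ℂ) {c : CP 5 × CP 5} (hc : c ∈ pairs) :
    (transformConic g c.1, transformConic g c.2) ∈ pairs := by
  obtain ⟨c, d⟩ := c
  induction c using Projectivization.ind with | h x hx => ?_
  induction d using Projectivization.ind with | h y hy => ?_
  obtain ⟨h1, h2, h3⟩ := hc
  have hdet : g⁻¹.1.det ≠ 0 := ((Matrix.isUnit_iff_isUnit_det _).1 g⁻¹.isUnit).ne_zero
  simp only at h1 h2 h3
  rw [isNondegenerate_mk] at h1 h2
  rw [isTransverse_mk] at h3
  refine ⟨?_, ?_, ?_⟩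
  · simp only [transformConic_mk]
    rw [isNondegenerate_mk, conicMatrix_transform, Matrix.det_mul, Matrix.det_mul,
      Matrix.det_transpose]
    exact mul_ne_zero (mul_ne_zero hdet h1) hdet
  · simp only [transformConic_mk]
    rw [isNondegenerate_mk, conicMatrix_transform, Matrix.det_mul, Matrix.det_mul,
      Matrix.det_transpose]
    exact mul_ne_zero (mul_ne_zero hdet h2) hdet
  · simp only [transformConic_mk]
    rw [isTransverse_mk]
    intro v hv
    simp only [conicMatrix_transform, ← Matrix.mulVec_mulVec]
    have hw : g⁻¹.1 *ᵥ v ≠ 0 := by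
      intro h0
      apply hv
      have : g.1 *ᵥ (g⁻¹.1 *ᵥ v) = v := by
        rw [Matrix.mulVec_mulVec, ← Units.val_mul, mul_inv_cancel, Units.val_one,
          Matrix.one_mulVec]
      rw [← this, h0, Matrix.mulVec_zero]
    have hdot : ∀ u, v ⬝ᵥ g⁻¹.1ᵀ *ᵥ u = (g⁻¹.1 *ᵥ v) ⬝ᵥ u := fun u => by
      rw [Matrix.dotProduct_mulVec, Matrix.vecMul_transpose]
    rw [hdot, hdot]
    intro e1 e2
    have hli := h3 _ hw e1 e2
    have hinj : Function.Injective (Matrix.mulVecLin g⁻¹.1ᵀ) := by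
      rw [Matrix.coe_mulVecLin, Matrix.mulVec_injective_iff_isUnit,
        Matrix.isUnit_iff_isUnit_det, Matrix.det_transpose]
      exact hdet.isUnit
    have := hli.map' (Matrix.mulVecLin g⁻¹.1ᵀ) (LinearMap.ker_eq_bot.2 hinj)
    have heq : ∀ a b : Fin 3 → ℂ, Matrix.mulVecLin g⁻¹.1ᵀ ∘ ![a, b] =
        ![g⁻¹.1ᵀ *ᵥ a, g⁻¹.1ᵀ *ᵥ b] := fun a b => by
      ext i : 1
      fin_cases i <;> rfl
    rw [heq] at this
    exact this

instance : MulAction (GL (Fin 3) ℂ) pairs where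
  smul g c := ⟨(transformConic g c.1.1, transformConic g c.1.2), transformConic_mem g c.2⟩
  one_smul c := by
    have h : ∀ c : CP 5, transformConic 1 c = c := fun c => by
      induction c using Projectivization.ind with | h x hx => ?_
      simp only [transformConic_mk, transform_one]
    exact Subtype.ext (Prod.ext (h _) (h _))
  mul_smul g g' c := by
    have h : ∀ c : CP 5, transformConic (g * g') c = transformConic g (transformConic g' c) :=
      fun c => by
        induction c using Projectivization.ind with | h x hx => ?_
        simp only [transformConic_mk, transform_mul]
    exact Subtype.ext (Prod.ext (h _) (h _))

/-- The action of `PGL(3, ℂ)` on pairs of conics by congruence: the class of `A⁻¹` sends `(C, D)`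
to the pair of conics with matrices `Aᵀ C A`, `Aᵀ D A`. -/
instance : MulAction PGL(3, ℂ) pairs :=
  Matrix.ProjGenLinGroup.mulActionOfGL (by
    intro u c
    have h : ∀ c : CP 5, transformConic (Matrix.GeneralLinearGroup.scalar (Fin 3) u) c = c :=
      fun c => by
        induction c using Projectivization.ind with | h x hx => ?_
        simp only [transformConic_mk, transform_scalar]
        rw [Projectivization.mk_eq_mk_iff]
        exact ⟨_, rfl⟩
    exact Subtype.ext (Prod.ext (h _) (h _)))

theorem conicCoords_diagonal_ne_zero {l : Fin 3 → ℂ} (hl : l 0 ≠ 0) :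
    conicCoords (Matrix.diagonal l) ≠ 0 := fun h => hl (congrFun h 0)

/-- The diagonal conic `l₀ x² + l₁ y² + l₂ z² = 0`. -/
def diagConic (l : Fin 3 → ℂ) (hl : ∀ i, l i ≠ 0) : CP 5 :=
  Projectivization.mk ℂ (conicCoords (Matrix.diagonal l)) (conicCoords_diagonal_ne_zero (hl 0))

/-- The pair of conics `(I₃, diag (l₀, l₁, l₂))`, for distinct non-zero `l₀, l₁, l₂`. -/
def diagPair (l : Fin 3 → ℂ) (hinj : Function.Injective l) (hl : ∀ i, l i ≠ 0) : pairs :=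
  ⟨(diagConic 1 (fun _ => one_ne_zero), diagConic l hl), by
    have hM : ∀ m : Fin 3 → ℂ, conicMatrix (conicCoords (Matrix.diagonal m)) =
      Matrix.diagonal m := fun m => conicMatrix_conicCoords (Matrix.diagonal_transpose m)
    refine ⟨?_, ?_, ?_⟩
    · simp only [diagConic]
      rw [isNondegenerate_mk, hM]
      simp
    · simp [diagConic, isNondegenerate_mk, hM, Matrix.det_diagonal, Finset.prod_ne_zero_iff, hl]
    · simp only [diagConic]
      rw [isTransverse_mk, hM, hM]
      intro v hv h1 _
      rw [LinearIndependent.pair_iff]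
      intro a b hab
      have hab' : ∀ i, (a + b * l i) * v i = 0 := fun i => by
        have := congrFun hab i
        simp [Matrix.mulVec_diagonal] at this
        linear_combination this
      have h1' : v 0 * v 0 + v 1 * v 1 + v 2 * v 2 = 0 := by
        simpa [dotProduct, Matrix.mulVec_diagonal, Fin.sum_univ_three] using h1
      -- two coordinates of `v` do not vanish
      obtain ⟨i, j, hij, hi, hj⟩ : ∃ i j, i ≠ j ∧ v i ≠ 0 ∧ v j ≠ 0 := by
        by_contra! hcon
        obtain ⟨i, hi⟩ : ∃ i, v i ≠ 0 := by
          by_contra! h0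
          exact hv (funext h0)
        have h0 : ∀ j, i ≠ j → v j = 0 := fun j hj => hcon i j hj hi
        apply hi
        fin_cases i
        · simpa [h0 1 (by decide), h0 2 (by decide)] using h1'
        · simpa [h0 0 (by decide), h0 2 (by decide)] using h1'
        · simpa [h0 0 (by decide), h0 1 (by decide)] using h1'
      have ei := (mul_eq_zero.1 (hab' i)).resolve_right hi
      have ej := (mul_eq_zero.1 (hab' j)).resolve_right hj
      have hb : b * (l i - l j) = 0 := by linear_combination ei - ej
      have hb0 : b = 0 := (mul_eq_zero.1 hb).resolve_right (sub_ne_zero.2 (hinj.ne hij))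
      refine ⟨by simpa [hb0] using ei, hb0⟩⟩

/-- The class in `PGL(3, ℂ)` of the diagonal matrix with entries `ε 0, ε 1, ε 2 = ±1`. -/
def signs : (Fin 3 → ℤˣ) →* PGL(3, ℂ) :=
  Matrix.ProjGenLinGroup.mk.comp
    (Units.map ((Matrix.diagonalRingHom (Fin 3) ℂ).comp
      ((Int.castRingHom ℂ).compLeft (Fin 3)) : (Fin 3 → ℤ) →* Matrix (Fin 3) (Fin 3) ℂ) |>.comp
        MulEquiv.piUnits.symm.toMonoidHom)

/-- The group `V₄` of classes of diagonal matrices with entries `±1`. -/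
def V4 : Subgroup PGL(3, ℂ) := signs.range

/-- The permutation matrix of the 3-cycle `0 ↦ 1 ↦ 2 ↦ 0`. -/
def cycleMatrix : GL (Fin 3) ℂ where
  val := !![0, 0, 1; 1, 0, 0; 0, 1, 0]
  inv := !![0, 1, 0; 0, 0, 1; 1, 0, 0]
  val_inv := by
    ext i j
    fin_cases i <;> fin_cases j <;> simp [Matrix.mul_apply, Fin.sum_univ_three]
  inv_val := by
    ext i j
    fin_cases i <;> fin_cases j <;> simp [Matrix.mul_apply, Fin.sum_univ_three]

/-- The cyclic group of order three generated by the class of `cycleMatrix`. -/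
def Z3 : Subgroup PGL(3, ℂ) := Subgroup.zpowers (Matrix.ProjGenLinGroup.mk cycleMatrix)

/-- Conjugation by the 3-cycle permutes the diagonal entries cyclically. -/
theorem cycle_conj (ε : Fin 3 → ℤˣ) :
    Matrix.ProjGenLinGroup.mk cycleMatrix * signs ε * (Matrix.ProjGenLinGroup.mk cycleMatrix)⁻¹ =
      signs ![ε 2, ε 0, ε 1] := by
  rw [mul_inv_eq_iff_eq_mul]
  simp only [signs, MonoidHom.comp_apply, ← map_mul]
  congr 1
  ext i j
  fin_cases i <;> fin_cases j <;>
    simp [Matrix.mul_apply, cycleMatrix, Matrix.diagonal]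

theorem Z3_le_normalizer : Z3 ≤ Subgroup.normalizer (V4 : Set PGL(3, ℂ)) := by
  rw [Z3, Subgroup.zpowers_le, Subgroup.mem_normalizer_iff]
  intro h
  constructor
  · rintro ⟨ε, rfl⟩
    exact ⟨_, (cycle_conj ε).symm⟩
  · rintro ⟨ε, hε⟩
    refine ⟨![ε 1, ε 2, ε 0], ?_⟩
    have : Matrix.ProjGenLinGroup.mk cycleMatrix * signs ![ε 1, ε 2, ε 0] *
        (Matrix.ProjGenLinGroup.mk cycleMatrix)⁻¹ = signs ε := by
      rw [cycle_conj]
      congr 1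
      ext i
      fin_cases i <;> rfl
    rw [hε] at this
    simpa using this

/-- The action `Φ` of `ℤ₃` on `V₄` by cyclic permutations of the diagonal entries. -/
def cyclicAction : Z3 →* MulAut V4 :=
  V4.normalizerMonoidHom.comp (Subgroup.inclusion Z3_le_normalizer)

/-- The canonical homomorphism `V₄ ⋊ ℤ₃ → PGL(3, ℂ)`, `(a, b) ↦ a b`. -/
def semidirectToPGL : V4 ⋊[cyclicAction] Z3 →* PGL(3, ℂ) :=
  SemidirectProduct.monoidHomSubgroup Z3_le_normalizer

/-- The image of `V₄ ⋊ ℤ₃` in `PGL(3, ℂ)`. -/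
def V4Z3 : Subgroup PGL(3, ℂ) := semidirectToPGL.range

instance : Finite V4 := Finite.of_surjective _ signs.rangeRestrict_surjective

instance : Finite Z3 := by
  have h : cycleMatrix ^ 3 = 1 := by
    ext i j
    fin_cases i <;> fin_cases j <;>
      simp [cycleMatrix, pow_succ, Matrix.mul_apply, Fin.sum_univ_three]
  have h' : IsOfFinOrder (Matrix.ProjGenLinGroup.mk cycleMatrix : PGL(3, ℂ)) :=
    isOfFinOrder_iff_pow_eq_one.2 ⟨3, by norm_num, by rw [← map_pow, h, map_one]⟩
  exact h'.finite_zpowers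

instance : Finite V4Z3 := by
  have : Finite (V4 ⋊[cyclicAction] Z3) := Finite.of_equiv _ SemidirectProduct.equivProd.symm
  exact Finite.of_surjective _ semidirectToPGL.rangeRestrict_surjective

/-- The primitive cube root of unity `exp (2πi/3)`. -/
def omega : ℂ := Complex.exp (2 * Real.pi * Complex.I / 3)

theorem isPrimitiveRoot_omega : IsPrimitiveRoot omega 3 := by
  simpa [omega] using Complex.isPrimitiveRoot_exp 3 (by norm_num)

/-- The pair of conics `(I₃, diag (1, ω, ω²))`. -/
def specialPair : pairs :=
  diagPair ![1, omega, omega ^ 2]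
    (by
      have h1 : omega ≠ 1 := isPrimitiveRoot_omega.ne_one (by norm_num)
      have h2 : omega ^ 2 ≠ 1 := isPrimitiveRoot_omega.pow_ne_one_of_pos_of_lt (by norm_num)
        (by norm_num)
      have h3 : omega ≠ 0 := isPrimitiveRoot_omega.ne_zero (by norm_num)
      have h4 : omega ^ 2 ≠ omega := fun h => h1 (mul_left_cancel₀ h3 (by linear_combination h))
      intro i j
      fin_cases i <;> fin_cases j <;> simp [h1, h2, h4, h1.symm, h2.symm, h4.symm])
    (by
      have h3 : omega ≠ 0 := isPrimitiveRoot_omega.ne_zero (by norm_num)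
      intro i
      fin_cases i <;> simp [h3])

/-- The orbit of a pair of conics under the group of projective transformations. -/
abbrev orbit (p : pairs) : Set pairs := MulAction.orbit PGL(3, ℂ) p

/-- The subset `S ⊆ 𝔒`, with its subspace topology and the given charts with values in `ℂᵏ`, is an
embedded complex submanifold of dimension `k`: the charts define a complex manifold structure and
the inclusion is a holomorphic immersion and a topological embedding. -/
structure IsEmbeddedComplexSubmanifold (k : ℕ) (S : Set pairs) [ChartedSpace (Fin k → ℂ) S] :
    Prop where
  isManifold : IsManifold 𝓘(ℂ, Fin k → ℂ) ω S
  isSmoothEmbedding : Manifold.IsSmoothEmbedding 𝓘(ℂ, Fin k → ℂ)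
    (𝓘(ℂ, Fin 5 → ℂ).prod 𝓘(ℂ, Fin 5 → ℂ)) ω (Subtype.val : S → pairs)

/-- There is a biholomorphic map between the two complex manifolds of dimension `k`. -/
def Biholomorphic (k : ℕ) (M N : Type) [TopologicalSpace M] [ChartedSpace (Fin k → ℂ) M]
    [TopologicalSpace N] [ChartedSpace (Fin k → ℂ) N] : Prop :=
  Nonempty (Diffeomorph 𝓘(ℂ, Fin k → ℂ) 𝓘(ℂ, Fin k → ℂ) M N ω)

end
end ConicPairs

open scoped Manifold ContDiff Topology MatrixGroups LinearAlgebra.Projectivization Matrix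
open ConicPairs

namespace ConicPairs

open Matrix (ProjGenLinGroup)

noncomputable section

/-! The class of `A` acts by `C ↦ A⁻¹ᵀ C A⁻¹` on both conics, and every question is reduced to
matrix equations at a diagonal pair. Transversality forbids an eigenvector of `C⁻¹ D` that is
isotropic for `C`: it would be a common point with a common tangent. Hence `C⁻¹ D` has a
`C`-orthonormal eigenbasis with distinct eigenvalues, and each orbit contains some `(I₃, diag l)`
with `l` injective and non-vanishing (`exists_smul_eq_diagPair`).

A matrix taking `(I₃, diag l)` to multiples of `(I₃, diag m)` intertwines two diagonal matrices with
simple spectrum, so it is monomial, and its permutation `τ` satisfies `l ∘ τ = t • m` for some `t`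
(`exists_perm_of_congr`). For `m = l` the product of the entries gives `t³ = 1`. If `τ ≠ 1`, then `t
≠ 1` and `l` is a reordered multiple of `(1, ω, ω²)`. Otherwise the matrix is diagonal with entries
equal up to sign. So the stabilizer is `V₄` in the standard case and `V₄ ⋊ ℤ₃` in the special one
(`stabilizer_eq_V4`, `stabilizer_specialPair`).

For the geometry, consider `(A, v) ↦ A • (I₃, diag (l₀, l₁ + v₀, l₂ + v₁))`. Source and target have
dimension `8 + 2 = 5 + 5`, and the derivative is injective (`fderiv_sliceMap_injective`), so this is
a local biholomorphism. By monomiality only finitely many `v` give pairs in the orbit of `diag l`;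
near `v = 0` the orbit is therefore exactly the slice `v = 0` (`exists_slice`). This has two
consequences: the orbit map is open for the subspace topology, so the orbit is homeomorphic to `G`
modulo the stabilizer; and the inclusion reads `u ↦ (u, 0)` in suitable charts, so it is an
immersion. The orbit receives the charts of the quotient through the homeomorphism, which makes the
latter biholomorphic. Connectedness comes from that of `G`. -/

/-! ### The finite groups `V₄`, `ℤ₃` and `V₄ ⋊ ℤ₃` -/

/-- The diagonal matrix with entries `ε 0, ε 1, ε 2 = ±1`. -/
def signMatrix : (Fin 3 → ℤˣ) →* GL (Fin 3) ℂ :=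
  Units.map ((Matrix.diagonalRingHom (Fin 3) ℂ).comp
      ((Int.castRingHom ℂ).compLeft (Fin 3)) : (Fin 3 → ℤ) →* Matrix (Fin 3) (Fin 3) ℂ) |>.comp
        MulEquiv.piUnits.symm.toMonoidHom

theorem signs_apply (ε : Fin 3 → ℤˣ) : signs ε = ProjGenLinGroup.mk (signMatrix ε) := rfl

theorem coe_signMatrix (ε : Fin 3 → ℤˣ) :
    (signMatrix ε).1 = Matrix.diagonal fun i => (((ε i : ℤˣ) : ℤ) : ℂ) := rfl

theorem mul_scalar_apply (g : GL (Fin 3) ℂ) (u : ℂˣ) (i j : Fin 3) :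
    (g * Matrix.GeneralLinearGroup.scalar (Fin 3) u).1 i j = g.1 i j * u := by
  rw [Units.val_mul, Matrix.GeneralLinearGroup.coe_scalar, Matrix.scalar_apply,
    Matrix.mul_diagonal]

theorem intUnits_sq (s : ℤˣ) : (((s : ℤˣ) : ℤ) : ℂ) * ((s : ℤ) : ℂ) = 1 := by
  rcases Int.units_eq_one_or s with rfl | rfl <;> simp

theorem signs_smul (s : ℤˣ) (ε : Fin 3 → ℤˣ) : signs (s • ε) = signs ε := by
  rw [signs_apply, signs_apply, eq_comm, ProjGenLinGroup.mk_eq_mk_iff]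
  refine ⟨Units.map (Int.castRingHom ℂ).toMonoidHom s, ?_⟩
  ext i j
  rw [mul_scalar_apply]
  rcases eq_or_ne i j with rfl | h
  · simp [coe_signMatrix, mul_comm]
  · simp [coe_signMatrix, h]

/-- Equal classes differ by a scalar, and agreement of the first entries forces that scalar to be
`1`. -/
theorem eq_of_signs_eq {ε δ : Fin 3 → ℤˣ} (h : signs ε = signs δ) (h0 : ε 0 = δ 0) : ε = δ := by
  rw [signs_apply, signs_apply, ProjGenLinGroup.mk_eq_mk_iff] at h
  obtain ⟨u, hu⟩ := h
  have key : ∀ i, (((ε i : ℤˣ) : ℤ) : ℂ) * u = ((δ i : ℤˣ) : ℤ) := fun i => by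
    have := congrArg (fun g : GL (Fin 3) ℂ => g.1 i i) hu
    simpa [mul_scalar_apply, coe_signMatrix] using this
  have hu1 : (u : ℂ) = 1 := by
    have h1 := key 0
    rw [h0] at h1
    linear_combination ((δ 0 : ℤˣ) : ℤ) * h1 + (1 - (u : ℂ)) * intUnits_sq (δ 0)
  ext i
  have := key i
  rw [hu1, mul_one] at this
  exact_mod_cast this

/-- Every class in `V₄` has exactly one representative with first entry `1`. -/
theorem bijective_normalizedSigns :
    Function.Bijective fun a : ℤˣ × ℤˣ => (⟨signs ![1, a.1, a.2], ⟨_, rfl⟩⟩ : V4) := by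
  constructor
  · rintro ⟨a, b⟩ ⟨c, d⟩ h
    have h' := eq_of_signs_eq (congrArg Subtype.val h) rfl
    exact Prod.ext (congrFun h' 1) (congrFun h' 2)
  · rintro ⟨_, ε, rfl⟩
    refine ⟨(ε 0 * ε 1, ε 0 * ε 2), Subtype.ext ((congrArg signs ?_).trans (signs_smul (ε 0) ε))⟩
    ext i
    fin_cases i <;> simp

theorem card_V4 : Nat.card V4 = 4 := by
  rw [← Nat.card_eq_of_bijective _ bijective_normalizedSigns]
  simp

theorem isKleinFour_V4 : IsKleinFour V4 := by
  refine ⟨card_V4, ?_⟩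
  have h : Monoid.exponent V4 ∣ 2 := by
    rw [Monoid.exponent_dvd_iff_forall_pow_eq_one]
    rintro ⟨_, ε, rfl⟩
    refine Subtype.ext ?_
    change signs ε ^ 2 = 1
    rw [← map_pow]
    have : ε ^ 2 = 1 := by
      ext i
      simp [Int.units_sq]
    rw [this, map_one]
  rcases (Nat.dvd_prime Nat.prime_two).1 h with h | h
  -- Exponent `1` would make the group trivial, against its order `4`.
  · rw [Monoid.exp_eq_one_iff] at h
    have := card_V4
    rw [Nat.card_of_subsingleton (1 : V4)] at this
    omega
  · exact h

theorem cycleMatrix_pow_three : cycleMatrix ^ 3 = 1 := by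
  ext i j
  fin_cases i <;> fin_cases j <;>
    simp [cycleMatrix, pow_succ, Matrix.mul_apply, Fin.sum_univ_three]

theorem card_Z3 : Nat.card Z3 = 3 := by
  rw [Z3, Nat.card_zpowers]
  refine orderOf_eq_prime (by rw [← map_pow, cycleMatrix_pow_three, map_one]) ?_
  rw [← map_one ProjGenLinGroup.mk, Ne, eq_comm, ProjGenLinGroup.mk_eq_mk_iff]
  rintro ⟨u, hu⟩
  have := congrArg (fun g : GL (Fin 3) ℂ => g.1 1 0) hu
  simp only [mul_scalar_apply] at this
  simp [cycleMatrix] at this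

/-- The orders `4` and `3` are coprime, so the two subgroups meet trivially and a product `a b`
determines its factors. -/
theorem semidirectToPGL_injective : Function.Injective semidirectToPGL := by
  have hd : Disjoint V4 Z3 := Subgroup.disjoint_of_coprime_natCard
    (by rw [card_V4, card_Z3]; decide)
  intro x y h
  have h' : (x.left : PGL(3, ℂ)) * x.right = y.left * y.right := h
  have := Subgroup.mul_injective_of_disjoint hd
    (a₁ := (x.left, x.right)) (a₂ := (y.left, y.right)) h'
  exact SemidirectProduct.ext (congrArg Prod.fst this) (congrArg Prod.snd this)

theorem V4_le_V4Z3 : V4 ≤ V4Z3 := fun a ha =>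
  ⟨SemidirectProduct.inl ⟨a, ha⟩, mul_one a⟩

theorem Z3_le_V4Z3 : Z3 ≤ V4Z3 := fun b hb =>
  ⟨SemidirectProduct.inr ⟨b, hb⟩, one_mul b⟩

theorem V4Z3_le {H : Subgroup PGL(3, ℂ)} (h1 : V4 ≤ H) (h2 : Z3 ≤ H) : V4Z3 ≤ H := by
  rintro _ ⟨x, rfl⟩
  exact H.mul_mem (h1 x.left.2) (h2 x.right.2)

/-! ### The action as congruence of matrices -/

theorem mk_smul_val (g : GL (Fin 3) ℂ) (p : pairs) :
    (ProjGenLinGroup.mk g • p).1 = (transformConic g p.1.1, transformConic g p.1.2) := rfl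

theorem transformConic_mk_eq_mk_iff (g : GL (Fin 3) ℂ) {x y : Fin (5 + 1) → ℂ} (hx : x ≠ 0)
    (hy : y ≠ 0) :
    transformConic g (Projectivization.mk ℂ x hx) = Projectivization.mk ℂ y hy ↔
      ∃ c : ℂ, c ≠ 0 ∧ g⁻¹.1ᵀ * conicMatrix x * g⁻¹.1 = c • conicMatrix y := by
  rw [transformConic_mk, Projectivization.mk_eq_mk_iff]
  constructor
  · rintro ⟨u, hu⟩
    exact ⟨u, u.ne_zero, by rw [← conicMatrix_transform, ← hu, Units.smul_def, map_smul]⟩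
  · rintro ⟨c, hc, h⟩
    refine ⟨Units.mk0 c hc, conicMatrix_injective ?_⟩
    rw [conicMatrix_transform, h, Units.smul_def, map_smul, Units.val_mk0]

theorem conicMatrix_diagonal (l : Fin 3 → ℂ) :
    conicMatrix (conicCoords (Matrix.diagonal l)) = Matrix.diagonal l :=
  conicMatrix_conicCoords (Matrix.diagonal_transpose l)

/-- Turns the orbit problem into two equations for the inverse matrix. The two scalars are
independent because each conic is a projective point of its own. -/
theorem smul_diagPair_eq_iff (g : GL (Fin 3) ℂ) {l m : Fin 3 → ℂ} (hl : Function.Injective l)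
    (hl0 : ∀ i, l i ≠ 0) (hm : Function.Injective m) (hm0 : ∀ i, m i ≠ 0) :
    ProjGenLinGroup.mk g • diagPair l hl hl0 = diagPair m hm hm0 ↔
      (∃ c : ℂ, c ≠ 0 ∧ g⁻¹.1ᵀ * g⁻¹.1 = c • 1) ∧
      ∃ c : ℂ, c ≠ 0 ∧ g⁻¹.1ᵀ * Matrix.diagonal l * g⁻¹.1 = c • Matrix.diagonal m := by
  rw [Subtype.ext_iff, mk_smul_val, Prod.ext_iff]
  refine and_congr ((transformConic_mk_eq_mk_iff _ _ _).trans ?_)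
    ((transformConic_mk_eq_mk_iff _ _ _).trans ?_)
  · rw [conicMatrix_diagonal, Matrix.diagonal_one', mul_one]
  · rw [conicMatrix_diagonal, conicMatrix_diagonal]

/-- A matrix that takes the pair of forms `(I₃, diag l)` to multiples of `(I₃, diag m)` is
monomial. -/
theorem exists_perm_of_congr {B : Matrix (Fin 3) (Fin 3) ℂ} {l m : Fin 3 → ℂ}
    (hl : Function.Injective l) (hm : Function.Injective m) {c d : ℂ} (hc : c ≠ 0) (hd : d ≠ 0)
    (h1 : Bᵀ * B = c • 1) (h2 : Bᵀ * Matrix.diagonal l * B = d • Matrix.diagonal m) :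
    ∃ τ : Equiv.Perm (Fin 3), (∀ i j, i ≠ τ j → B i j = 0) ∧ (∀ j, B (τ j) j * B (τ j) j = c) ∧
      ∃ t : ℂ, t ≠ 0 ∧ ∀ j, l (τ j) = t * m j := by
  -- A left inverse of a square matrix is also a right inverse.
  have h1' : B * Bᵀ = c • 1 := by
    have h : (c⁻¹ • Bᵀ) * B = 1 := by
      rw [Matrix.smul_mul, h1, smul_smul, inv_mul_cancel₀ hc, one_smul]
    rw [mul_eq_one_comm, Matrix.mul_smul, inv_smul_eq_iff₀ hc] at h
    exact h
  -- Multiplying `h2` by `B` on the left gives `c • diag l * B = d • B * diag m`. Read entrywise, a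
  -- non-zero `B i j` ties `l i` to `m j`; injectivity of `l` and of `m` then leaves at most one
  -- non-zero entry in each column and in each row.
  have key : ∀ i j, B i j ≠ 0 → l i = d / c * m j := by
    intro i j hij
    have e : c • (Matrix.diagonal l * B) = d • (B * Matrix.diagonal m) := by
      rw [← (Matrix.mul_smul B d (Matrix.diagonal m)), ← h2, ← mul_assoc, ← mul_assoc, h1',
        Matrix.smul_mul, Matrix.smul_mul, one_mul]
    have e' := congrArg (fun M : Matrix (Fin 3) (Fin 3) ℂ => M i j) e
    simp only [Matrix.smul_apply, Matrix.diagonal_mul, Matrix.mul_diagonal, smul_eq_mul] at e'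
    field_simp
    apply mul_right_cancel₀ hij
    linear_combination e'
  have hcol : ∀ j, ∃ i, B i j ≠ 0 := by
    intro j
    by_contra! h
    have := congrArg (fun M : Matrix (Fin 3) (Fin 3) ℂ => M j j) h1
    simp [Matrix.mul_apply, h, hc.symm] at this
  choose τ hτ using hcol
  have hτi : Function.Injective τ := by
    intro j k hjk
    have h3 := key _ _ (hτ j)
    rw [hjk, key _ _ (hτ k)] at h3
    exact (hm (mul_left_cancel₀ (div_ne_zero hd hc) h3)).symm
  have h0 : ∀ i j, i ≠ τ j → B i j = 0 := by
    intro i j hij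
    by_contra h
    exact hij (hl ((key _ _ h).trans (key _ _ (hτ j)).symm))
  refine ⟨Equiv.ofBijective τ (Finite.injective_iff_bijective.1 hτi), h0, fun j => ?_, d / c,
    div_ne_zero hd hc, fun j => key _ _ (hτ j)⟩
  have := congrArg (fun M : Matrix (Fin 3) (Fin 3) ℂ => M j j) h1
  simp only [Matrix.mul_apply, Matrix.transpose_apply, Matrix.smul_apply, Matrix.one_apply_eq,
    smul_eq_mul, mul_one] at this
  rw [Finset.sum_eq_single (τ j)] at this
  · exact this
  · intro i _ hi
    rw [h0 i j hi, mul_zero]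
  · simp

/-- Diagonal entries with a common square agree up to sign, so dividing by the first one leaves a
sign matrix. -/
theorem mk_mem_V4 {B : GL (Fin 3) ℂ} {c : ℂ} (h0 : ∀ i j, i ≠ j → B.1 i j = 0)
    (h1 : ∀ j, B.1 j j * B.1 j j = c) : ProjGenLinGroup.mk B ∈ V4 := by
  have hne : ∀ j, B.1 j j ≠ 0 := by
    intro j hj
    have hdet := ((Matrix.isUnit_iff_isUnit_det _).1 B.isUnit).ne_zero
    refine hdet (Matrix.det_eq_zero_of_row_eq_zero j fun k => ?_)
    rcases eq_or_ne j k with rfl | h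
    · exact hj
    · exact h0 _ _ h
  have hs : ∀ j, ∃ s : ℤˣ, B.1 j j = B.1 0 0 * ((s : ℤ) : ℂ) := by
    intro j
    rcases mul_self_eq_mul_self_iff.1 ((h1 j).trans (h1 0).symm) with h | h
    · exact ⟨1, by simpa using h⟩
    · exact ⟨-1, by simpa using h⟩
  choose ε hε using hs
  refine ⟨ε, ?_⟩
  rw [signs_apply, ProjGenLinGroup.mk_eq_mk_iff]
  refine ⟨Units.mk0 _ (hne 0), ?_⟩
  ext i j
  rw [mul_scalar_apply, coe_signMatrix]
  rcases eq_or_ne i j with rfl | h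
  · rw [Matrix.diagonal_apply_eq, Units.val_mk0, hε i, mul_comm]
  · rw [Matrix.diagonal_apply_ne _ h, h0 _ _ h, zero_mul]

/-! ### Stabilizers of diagonal pairs -/

theorem omega_pow_three : omega ^ 3 = 1 := isPrimitiveRoot_omega.pow_eq_one

theorem omega_ne_zero : omega ≠ 0 := isPrimitiveRoot_omega.ne_zero (by norm_num)

/-- The condition that `l` is, up to a permutation, a multiple of `(1, ω, ω²)`. -/
def IsSpecial (l : Fin 3 → ℂ) : Prop :=
  ∃ (σ : Equiv.Perm (Fin 3)) (t : ℂ), l ∘ σ = t • ![1, omega, omega ^ 2]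

theorem injective_special : Function.Injective ![1, omega, omega ^ 2] := by
  have h1 : omega ≠ 1 := isPrimitiveRoot_omega.ne_one (by norm_num)
  have h2 : omega ^ 2 ≠ 1 := isPrimitiveRoot_omega.pow_ne_one_of_pos_of_lt (by norm_num)
    (by norm_num)
  have h4 : omega ^ 2 ≠ omega := fun h =>
    h1 (mul_left_cancel₀ omega_ne_zero (by linear_combination h))
  intro i j
  fin_cases i <;> fin_cases j <;> simp [h1, h2, h4, h1.symm, h2.symm, h4.symm]

theorem special_ne_zero (i : Fin 3) : ![1, omega, omega ^ 2] i ≠ 0 := by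
  fin_cases i <;> simp [omega_ne_zero]

theorem specialPair_eq : specialPair = diagPair _ injective_special special_ne_zero := rfl

/-- Compare the products of all entries on both sides: a permutation does not change the product,
which is non-zero. -/
theorem pow_three_eq_one_of_perm {l : Fin 3 → ℂ} (hl0 : ∀ i, l i ≠ 0) {τ : Equiv.Perm (Fin 3)}
    {t : ℂ} (h : ∀ j, l (τ j) = t * l j) : t ^ 3 = 1 := by
  have h1 : ∏ j, l (τ j) = ∏ j, l j := Equiv.prod_comp τ l
  have h2 : ∏ j, l j ≠ 0 := Finset.prod_ne_zero_iff.2 fun j _ => hl0 j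
  simp only [h, Finset.prod_mul_distrib, Finset.prod_const, Finset.card_univ,
    Fintype.card_fin] at h1
  exact mul_right_cancel₀ h2 (by rw [h1, one_mul])

/-- Here `t` is a cube root of unity, and `t = 1` would force `τ = 1`. Following the index `0` under
`τ` then runs through `l 0`, `t * l 0`, `t² * l 0`, which are the multiples of `1, ω, ω²` in one
order or the other. -/
theorem isSpecial_of_perm_ne_one {l : Fin 3 → ℂ} (hl : Function.Injective l) (hl0 : ∀ i, l i ≠ 0)
    {τ : Equiv.Perm (Fin 3)} (hτ : τ ≠ 1) {t : ℂ} (h : ∀ j, l (τ j) = t * l j) : IsSpecial l := by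
  have ht1 : t ≠ 1 := by
    rintro rfl
    exact hτ (Equiv.ext fun j => hl (by simpa using h j))
  -- It is enough to find an index map `f` with the right values: these are distinct, so `f` is
  -- automatically a permutation.
  have aux : ∀ f : Fin 3 → Fin 3, l ∘ f = l 0 • ![1, omega, omega ^ 2] → IsSpecial l := by
    intro f hf
    have hinj : Function.Injective (l ∘ f) := by
      rw [hf]
      exact fun i j h => injective_special (mul_left_cancel₀ (hl0 0) h)
    replace hinj := hinj.of_comp
    exact ⟨Equiv.ofBijective f (Finite.injective_iff_bijective.1 hinj), l 0, hf⟩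
  obtain ⟨k, hk, rfl⟩ := isPrimitiveRoot_omega.eq_pow_of_pow_eq_one
    (pow_three_eq_one_of_perm hl0 h)
  interval_cases k
  · simp at ht1
  · refine aux ![0, τ 0, τ (τ 0)] ?_
    ext i
    fin_cases i
    · simp
    · simp [h, mul_comm]
    · simp [h]; ring
  -- For `t = ω²` the order is reversed, since `t² = ω⁴ = ω`.
  · refine aux ![0, τ (τ 0), τ 0] ?_
    ext i
    fin_cases i
    · simp
    · simp [h]; linear_combination omega * l 0 * omega_pow_three
    · simp [h]; ring

theorem mem_stabilizer_diagPair {l : Fin 3 → ℂ} (hl : Function.Injective l) (hl0 : ∀ i, l i ≠ 0)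
    {B : GL (Fin 3) ℂ}
    (h : ProjGenLinGroup.mk B ∈ MulAction.stabilizer PGL(3, ℂ) (diagPair l hl hl0)) :
    ∃ (τ : Equiv.Perm (Fin 3)) (c t : ℂ), (∀ i j, i ≠ τ j → B.1 i j = 0) ∧
      (∀ j, B.1 (τ j) j * B.1 (τ j) j = c) ∧ t ≠ 0 ∧ ∀ j, l (τ j) = t * l j := by
  -- The congruence equations involve the inverse of the acting matrix, so the inverse class is used
  -- in order to obtain equations for `B` itself.
  have h' := inv_mem h
  rw [← map_inv, MulAction.mem_stabilizer_iff, smul_diagPair_eq_iff, inv_inv] at h'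
  obtain ⟨⟨c, hc, h1⟩, d, hd, h2⟩ := h'
  obtain ⟨τ, h3, h4, t, ht, h5⟩ := exists_perm_of_congr hl hl hc hd h1 h2
  exact ⟨τ, c, t, h3, h4, ht, h5⟩

theorem V4_le_stabilizer {l : Fin 3 → ℂ} (hl : Function.Injective l) (hl0 : ∀ i, l i ≠ 0) :
    V4 ≤ MulAction.stabilizer PGL(3, ℂ) (diagPair l hl hl0) := by
  rintro _ ⟨ε, rfl⟩
  rw [signs_apply, MulAction.mem_stabilizer_iff, smul_diagPair_eq_iff, ← map_inv, coe_signMatrix]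
  refine ⟨⟨1, one_ne_zero, ?_⟩, 1, one_ne_zero, ?_⟩
  · rw [Matrix.diagonal_transpose, Matrix.diagonal_mul_diagonal, one_smul, ← Matrix.diagonal_one]
    exact congrArg _ (funext fun i => intUnits_sq _)
  · rw [Matrix.diagonal_transpose, Matrix.diagonal_mul_diagonal, Matrix.diagonal_mul_diagonal,
      one_smul]
    refine congrArg _ (funext fun i => ?_)
    linear_combination l i * intUnits_sq (ε⁻¹ i)

/-- A stabilizing matrix is monomial. A non-trivial permutation would make `l` special, so the
matrix is diagonal with entries of equal square. -/
theorem stabilizer_eq_V4 {l : Fin 3 → ℂ} (hl : Function.Injective l) (hl0 : ∀ i, l i ≠ 0)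
    (h : ¬ IsSpecial l) : MulAction.stabilizer PGL(3, ℂ) (diagPair l hl hl0) = V4 := by
  refine le_antisymm (fun g hg => ?_) (V4_le_stabilizer hl hl0)
  induction g using ProjGenLinGroup.induction_on with | mk B => ?_
  obtain ⟨τ, c, t, h1, h2, ht, h3⟩ := mem_stabilizer_diagPair hl hl0 hg
  have hτ : τ = 1 := by
    by_contra hτ
    exact h (isSpecial_of_perm_ne_one hl hl0 hτ h3)
  subst hτ
  exact mk_mem_V4 h1 h2

/-- The matrix whose `j`-th column is the `σ j`-th standard basis vector. -/
def permGL (σ : Equiv.Perm (Fin 3)) : GL (Fin 3) ℂ where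
  val := Matrix.of fun i j => if i = σ j then 1 else 0
  inv := Matrix.of fun i j => if j = σ i then 1 else 0
  val_inv := by
    ext i j
    rw [Matrix.mul_apply, Finset.sum_eq_single (σ.symm i)]
    · simp [Matrix.one_apply, eq_comm]
    · intro k _ hk
      have : i ≠ σ k := fun h => hk (by simp [h])
      simp [this]
    · simp
  inv_val := by
    ext i j
    rw [Matrix.mul_apply, Finset.sum_eq_single (σ i)]
    · simp [Matrix.one_apply]
    · intro k _ hk
      simp [hk]
    · simp

theorem permGL_apply (σ : Equiv.Perm (Fin 3)) (i j : Fin 3) :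
    (permGL σ).1 i j = if i = σ j then 1 else 0 := rfl

theorem transpose_permGL_mul_diagonal_mul (σ : Equiv.Perm (Fin 3)) (l : Fin 3 → ℂ) :
    (permGL σ).1ᵀ * Matrix.diagonal l * (permGL σ).1 = Matrix.diagonal (l ∘ σ) := by
  ext i j
  rw [Matrix.mul_apply, Finset.sum_eq_single (σ j)]
  · rw [Matrix.mul_diagonal, Matrix.transpose_apply, permGL_apply, permGL_apply]
    rcases eq_or_ne i j with rfl | h
    · simp
    · simp [h, h.symm]
  · intro k _ hk
    simp [permGL_apply, hk]
  · simp

theorem permGL_inv_smul_diagPair (σ : Equiv.Perm (Fin 3)) {t : ℂ} (ht : t ≠ 0) {l m : Fin 3 → ℂ}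
    (hl : Function.Injective l) (hl0 : ∀ i, l i ≠ 0) (hm : Function.Injective m)
    (hm0 : ∀ i, m i ≠ 0) (h : l ∘ σ = t • m) :
    ProjGenLinGroup.mk (permGL σ)⁻¹ • diagPair l hl hl0 = diagPair m hm hm0 := by
  rw [smul_diagPair_eq_iff, inv_inv]
  refine ⟨⟨1, one_ne_zero, ?_⟩, t, ht, ?_⟩
  · have := transpose_permGL_mul_diagonal_mul σ 1
    rw [Matrix.diagonal_one', mul_one] at this
    rw [this, one_smul]
    exact Matrix.diagonal_one
  · rw [transpose_permGL_mul_diagonal_mul, h, Matrix.diagonal_smul]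

theorem exists_smul_diagPair_eq_specialPair {l : Fin 3 → ℂ} (hl : Function.Injective l)
    (hl0 : ∀ i, l i ≠ 0) (h : IsSpecial l) :
    ∃ g : PGL(3, ℂ), g • diagPair l hl hl0 = specialPair := by
  obtain ⟨σ, t, h⟩ := h
  have ht : t ≠ 0 := by
    rintro rfl
    have := congrFun h 0
    simp [hl0] at this
  exact ⟨_, permGL_inv_smul_diagPair σ ht hl hl0 injective_special special_ne_zero h⟩

/-- The permutation and the factor of the monomial matrix are the data required by `IsSpecial`. -/
theorem isSpecial_of_smul_eq {l : Fin 3 → ℂ} (hl : Function.Injective l)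
    (hl0 : ∀ i, l i ≠ 0) {g : PGL(3, ℂ)} (h : g • diagPair l hl hl0 = specialPair) :
    IsSpecial l := by
  induction g using ProjGenLinGroup.induction_on with | mk g => ?_
  rw [specialPair_eq, smul_diagPair_eq_iff] at h
  obtain ⟨⟨c, hc, h1⟩, d, hd, h2⟩ := h
  obtain ⟨τ, -, -, t, -, h3⟩ := exists_perm_of_congr hl injective_special hc hd h1 h2
  exact ⟨τ, t, funext h3⟩

theorem cycleMatrix_apply (i j : Fin 3) : cycleMatrix.1 i j = if i = j + 1 then 1 else 0 := by
  fin_cases i <;> fin_cases j <;> rfl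

theorem cycleMatrix_eq_permGL : cycleMatrix = permGL (Equiv.addRight 1) := by
  ext i j
  rw [cycleMatrix_apply, permGL_apply]
  rfl

/-- Indices are added modulo `3`; the wrap-around is `ω³ = 1`. This is why the 3-cycle stabilizes
the special pair. -/
theorem special_add_one (j : Fin 3) :
    ![1, omega, omega ^ 2] (j + 1) = omega * ![1, omega, omega ^ 2] j := by
  fin_cases j
  · simp
  · simp [pow_two]
  · change 1 = omega * omega ^ 2
    linear_combination -omega_pow_three

theorem Z3_le_stabilizer : Z3 ≤ MulAction.stabilizer PGL(3, ℂ) specialPair := by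
  rw [Z3, Subgroup.zpowers_le, ← inv_mem_iff, ← map_inv, cycleMatrix_eq_permGL]
  exact permGL_inv_smul_diagPair _ omega_ne_zero injective_special special_ne_zero
    injective_special special_ne_zero (funext special_add_one)

theorem cycleMatrix_inv_mul_apply (B : GL (Fin 3) ℂ) (i j : Fin 3) :
    (cycleMatrix⁻¹ * B).1 i j = B.1 (i + 1) j := by
  have h : ∀ i j, cycleMatrix⁻¹.1 i j = if j = i + 1 then 1 else 0 := by
    intro i j
    fin_cases i <;> fin_cases j <;> rfl
  rw [Units.val_mul, Matrix.mul_apply]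
  simp only [h, ite_mul, one_mul, zero_mul, Finset.sum_ite_eq',
    Finset.mem_univ, if_true]

/-- The permutation of a stabilizing matrix multiplies the triple by some `ω ^ k`. Each left
multiplication by the inverse 3-cycle lowers `k` by one, and at `k = 0` the permutation is trivial
and the class lies in `V₄`. -/
theorem stabilizer_specialPair : MulAction.stabilizer PGL(3, ℂ) specialPair = V4Z3 := by
  refine le_antisymm (fun g hg => ?_)
    (V4Z3_le (V4_le_stabilizer injective_special special_ne_zero) Z3_le_stabilizer)
  induction g using ProjGenLinGroup.induction_on with | mk B => ?_
  rw [specialPair_eq] at hg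
  obtain ⟨τ, c, t, h1, h2, ht, h3⟩ := mem_stabilizer_diagPair injective_special special_ne_zero hg
  have hcyc : ProjGenLinGroup.mk cycleMatrix ∈ V4Z3 := Z3_le_V4Z3 (Subgroup.mem_zpowers _)
  have key : ∀ k : ℕ, t = omega ^ k → ProjGenLinGroup.mk B ∈ V4Z3 := by
    intro k
    induction k generalizing τ t B with
    | zero =>
      intro h
      have hτ : τ = 1 := Equiv.ext fun j => injective_special (by simpa [h] using h3 j)
      subst hτ
      exact V4_le_V4Z3 (mk_mem_V4 h1 h2)
    | succ k ih =>
      intro h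
      have hmem : ProjGenLinGroup.mk (cycleMatrix⁻¹ * B) ∈
          MulAction.stabilizer PGL(3, ℂ) (diagPair _ injective_special special_ne_zero) := by
        rw [map_mul, map_inv]
        exact mul_mem (inv_mem (Z3_le_stabilizer (Subgroup.mem_zpowers _))) hg
      have := ih _ hmem ((Equiv.addRight 1).symm * τ) (omega ^ k) ?_ ?_ ?_ ?_ rfl
      · rw [map_mul, map_inv] at this
        simpa using mul_mem hcyc this
      · intro i j hij
        rw [cycleMatrix_inv_mul_apply]
        refine h1 _ _ fun h => hij ?_
        rw [Equiv.Perm.mul_apply, ← h]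
        exact ((Equiv.addRight 1).symm_apply_apply i).symm
      · intro j
        rw [cycleMatrix_inv_mul_apply]
        have : ((Equiv.addRight 1).symm * τ : Equiv.Perm (Fin 3)) j + 1 = τ j :=
          (Equiv.addRight (1 : Fin 3)).apply_symm_apply (τ j)
        rw [this]
        exact h2 j
      · exact pow_ne_zero _ omega_ne_zero
      · intro j
        have : ((Equiv.addRight 1).symm * τ : Equiv.Perm (Fin 3)) j + 1 = τ j :=
          (Equiv.addRight (1 : Fin 3)).apply_symm_apply (τ j)
        have h4 := h3 j
        rw [← this, special_add_one, h, pow_succ omega k, mul_comm (omega ^ k),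
          mul_assoc] at h4
        exact mul_left_cancel₀ omega_ne_zero h4
  obtain ⟨k, -, hk⟩ := isPrimitiveRoot_omega.eq_pow_of_pow_eq_one
    (pow_three_eq_one_of_perm special_ne_zero h3)
  exact key k hk.symm

/-! ### Simultaneous diagonalization -/

theorem dotProduct_mulVec_comm {X : Matrix (Fin 3) (Fin 3) ℂ} (hX : Xᵀ = X) (v w : Fin 3 → ℂ) :
    v ⬝ᵥ X *ᵥ w = w ⬝ᵥ X *ᵥ v := by
  rw [Matrix.dotProduct_mulVec, ← Matrix.mulVec_transpose, hX, dotProduct_comm]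

/-- The operator `T = X⁻¹ Y` is self-adjoint for the form `X`, so it preserves the `X`-orthogonal
complement of eigenvectors `a`, `b`. Two linear conditions in dimension three leave a non-zero
subspace, and over `ℂ` the restriction of `T` has an eigenvector. The vectors `a`, `b` may vanish.
-/
theorem exists_orthogonal_eigenvector {X Y : Matrix (Fin 3) (Fin 3) ℂ} (hX : Xᵀ = X) (hY : Yᵀ = Y)
    (hdet : X.det ≠ 0) {a b : Fin 3 → ℂ} (ha : ∃ α : ℂ, Y *ᵥ a = α • X *ᵥ a)
    (hb : ∃ β : ℂ, Y *ᵥ b = β • X *ᵥ b) :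
    ∃ v : Fin 3 → ℂ, v ≠ 0 ∧ (∃ μ : ℂ, Y *ᵥ v = μ • X *ᵥ v) ∧ a ⬝ᵥ X *ᵥ v = 0 ∧
      b ⬝ᵥ X *ᵥ v = 0 := by
  let T : (Fin 3 → ℂ) →ₗ[ℂ] (Fin 3 → ℂ) := (X⁻¹ * Y).mulVecLin
  have hXT : ∀ v, X *ᵥ T v = Y *ᵥ v := fun v => by
    rw [Matrix.mulVecLin_apply, Matrix.mulVec_mulVec, ← mul_assoc,
      Matrix.mul_nonsing_inv _ hdet.isUnit, one_mul]
  let φ : (Fin 3 → ℂ) →ₗ[ℂ] (Fin 2 → ℂ) :=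
    (Matrix.of ![a, b]).mulVecLin ∘ₗ X.mulVecLin
  have hφ : ∀ v, v ∈ LinearMap.ker φ ↔ a ⬝ᵥ X *ᵥ v = 0 ∧ b ⬝ᵥ X *ᵥ v = 0 := fun v => by
    rw [LinearMap.mem_ker, funext_iff, Fin.forall_fin_two]
    rfl
  have hinv : ∀ {c v : Fin 3 → ℂ}, (∃ α : ℂ, Y *ᵥ c = α • X *ᵥ c) → c ⬝ᵥ X *ᵥ v = 0 →
      c ⬝ᵥ X *ᵥ T v = 0 := by
    rintro c v ⟨α, hα⟩ h
    rw [hXT, dotProduct_mulVec_comm hY, hα, dotProduct_smul, dotProduct_mulVec_comm hX, h,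
      smul_zero]
  have hT : ∀ v ∈ LinearMap.ker φ, T v ∈ LinearMap.ker φ := fun v hv => by
    rw [hφ] at hv ⊢
    exact ⟨hinv ha hv.1, hinv hb hv.2⟩
  have hne : LinearMap.ker φ ≠ ⊥ := LinearMap.ker_ne_bot_of_finrank_lt (by simp)
  have : Nontrivial (LinearMap.ker φ) := (Submodule.nontrivial_iff_ne_bot).2 hne
  obtain ⟨μ, hμ⟩ := Module.End.exists_eigenvalue (T.restrict hT)
  obtain ⟨v, hv⟩ := hμ.exists_hasEigenvector
  refine ⟨v, fun h => hv.2 (Subtype.ext h), ⟨μ, ?_⟩, (hφ v).1 v.2⟩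
  have h1 : T v = μ • (v : Fin 3 → ℂ) := congrArg Subtype.val hv.apply_eq_smul
  rw [← hXT, h1, Matrix.mulVec_smul]

/-- Simultaneous diagonalization of two transverse conics. -/
theorem exists_orthonormal_eigenbasis {X Y : Matrix (Fin 3) (Fin 3) ℂ} (hX : Xᵀ = X) (hY : Yᵀ = Y)
    (hdet : X.det ≠ 0)
    (h : ∀ v : Fin 3 → ℂ, v ≠ 0 → v ⬝ᵥ X *ᵥ v = 0 → v ⬝ᵥ Y *ᵥ v = 0 →
        LinearIndependent ℂ ![X *ᵥ v, Y *ᵥ v]) :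
    ∃ (A : Matrix (Fin 3) (Fin 3) ℂ) (μ : Fin 3 → ℂ), Aᵀ * X * A = 1 ∧
      Aᵀ * Y * A = Matrix.diagonal μ ∧ Function.Injective μ := by
  -- An isotropic eigenvector also satisfies `vᵀ Y v = 0`, so it is a common point of the conics,
  -- and there `Y v` is a multiple of `X v`, against transversality.
  have hiso : ∀ v : Fin 3 → ℂ, v ≠ 0 → (∃ μ : ℂ, Y *ᵥ v = μ • X *ᵥ v) → v ⬝ᵥ X *ᵥ v ≠ 0 := by
    rintro v hv ⟨μ, hμ⟩ h0
    have := h v hv h0 (by rw [hμ, dotProduct_smul, h0, smul_zero])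
    rw [LinearIndependent.pair_iff] at this
    have := this μ (-1) (by rw [hμ, neg_one_smul, add_neg_cancel])
    simp at this
  have hex : ∀ a b : Fin 3 → ℂ, (∃ α : ℂ, Y *ᵥ a = α • X *ᵥ a) →
      (∃ β : ℂ, Y *ᵥ b = β • X *ᵥ b) →
      ∃ v : Fin 3 → ℂ, (∃ μ : ℂ, Y *ᵥ v = μ • X *ᵥ v) ∧ a ⬝ᵥ X *ᵥ v = 0 ∧ b ⬝ᵥ X *ᵥ v = 0 ∧
        v ⬝ᵥ X *ᵥ v = 1 := by
    intro a b ha hb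
    obtain ⟨v, hv, ⟨μ, hμ⟩, h1, h2⟩ := exists_orthogonal_eigenvector hX hY hdet ha hb
    -- A square root of `vᵀ X v`, used to normalize `v`.
    obtain ⟨z, hz⟩ := IsAlgClosed.exists_pow_nat_eq (v ⬝ᵥ X *ᵥ v) two_pos
    have hz0 : z ≠ 0 := by
      rintro rfl
      exact hiso v hv ⟨μ, hμ⟩ (by simpa using hz.symm)
    refine ⟨z⁻¹ • v, ⟨μ, ?_⟩, ?_, ?_, ?_⟩
    · rw [Matrix.mulVec_smul, Matrix.mulVec_smul, hμ, smul_comm]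
    · rw [Matrix.mulVec_smul, dotProduct_smul, h1, smul_zero]
    · rw [Matrix.mulVec_smul, dotProduct_smul, h2, smul_zero]
    · rw [Matrix.mulVec_smul, dotProduct_smul, smul_dotProduct, ← hz]
      simp only [smul_eq_mul]
      field_simp
  -- The zero vector serves as a vacuous constraint, so that `hex` also yields the first two basis
  -- vectors.
  have h00 : ∃ α : ℂ, Y *ᵥ (0 : Fin 3 → ℂ) = α • X *ᵥ (0 : Fin 3 → ℂ) := ⟨0, by simp⟩
  obtain ⟨v₀, ⟨μ₀, hμ₀⟩, -, -, h₀⟩ := hex 0 0 h00 h00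
  obtain ⟨v₁, ⟨μ₁, hμ₁⟩, h₀₁, -, h₁⟩ := hex v₀ 0 ⟨_, hμ₀⟩ h00
  obtain ⟨v₂, ⟨μ₂, hμ₂⟩, h₀₂, h₁₂, h₂⟩ := hex v₀ v₁ ⟨_, hμ₀⟩ ⟨_, hμ₁⟩
  let V : Fin 3 → (Fin 3 → ℂ) := ![v₀, v₁, v₂]
  let μ : Fin 3 → ℂ := ![μ₀, μ₁, μ₂]
  have hV : ∀ i j, V i ⬝ᵥ X *ᵥ V j = (1 : Matrix (Fin 3) (Fin 3) ℂ) i j := by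
    intro i j
    fin_cases i <;> fin_cases j
    · simpa [V] using h₀
    · simpa [V] using h₀₁
    · simpa [V] using h₀₂
    · simpa [V, dotProduct_mulVec_comm hX v₁ v₀] using h₀₁
    · simpa [V] using h₁
    · simpa [V] using h₁₂
    · simpa [V, dotProduct_mulVec_comm hX v₂ v₀] using h₀₂
    · simpa [V, dotProduct_mulVec_comm hX v₂ v₁] using h₁₂
    · simpa [V] using h₂
  have hμ : ∀ j, Y *ᵥ V j = μ j • X *ᵥ V j := by
    intro j
    fin_cases j
    · exact hμ₀
    · exact hμ₁
    · exact hμ₂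
  have hent : ∀ (M : Matrix (Fin 3) (Fin 3) ℂ) (i j : Fin 3),
      ((Matrix.of V)ᵀᵀ * M * (Matrix.of V)ᵀ) i j = V i ⬝ᵥ M *ᵥ V j := by
    intro M i j
    rw [mul_assoc]
    rfl
  refine ⟨(Matrix.of V)ᵀ, μ, ?_, ?_, ?_⟩
  · ext i j
    rw [hent, hV]
  · ext i j
    rw [hent, hμ, dotProduct_smul, hV, Matrix.one_apply, Matrix.diagonal_apply]
    rcases eq_or_ne i j with rfl | hij
    · simp
    · simp [hij]
  · intro i j hij
    by_contra hne
    -- For a repeated eigenvalue, `V i + I • V j` is again an eigenvector, but it is isotropic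
    -- because `1 + I² = 0`; this contradicts `hiso`.
    have h1 : Y *ᵥ (V i + Complex.I • V j) = μ i • X *ᵥ (V i + Complex.I • V j) := by
      rw [Matrix.mulVec_add, Matrix.mulVec_add, Matrix.mulVec_smul, Matrix.mulVec_smul, hμ, hμ, hij,
        smul_add, smul_comm]
    have h2 : (V i + Complex.I • V j) ⬝ᵥ X *ᵥ (V i + Complex.I • V j) = 0 := by
      simp [Matrix.mulVec_add, Matrix.mulVec_smul, add_dotProduct, hV, hne, Ne.symm hne]
    refine hiso _ (fun h0 => ?_) ⟨_, h1⟩ h2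
    have h3 : V i ⬝ᵥ X *ᵥ (V i + Complex.I • V j) = 0 := by rw [h0]; simp
    simp [Matrix.mulVec_add, Matrix.mulVec_smul, hV, hne] at h3

theorem exists_smul_eq_diagPair (p : pairs) :
    ∃ (g : PGL(3, ℂ)) (l : Fin 3 → ℂ) (hl : Function.Injective l) (hl0 : ∀ i, l i ≠ 0),
      g • p = diagPair l hl hl0 := by
  obtain ⟨⟨c, d⟩, hp⟩ := p
  induction c using Projectivization.ind with | h x hx => ?_
  induction d using Projectivization.ind with | h y hy => ?_
  obtain ⟨h1, h2, h3⟩ := id hp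
  simp only at h1 h2 h3
  rw [isNondegenerate_mk] at h1 h2
  rw [isTransverse_mk] at h3
  obtain ⟨A, μ, hAX, hAY, hμ⟩ := exists_orthonormal_eigenbasis (conicMatrix_transpose x)
    (conicMatrix_transpose y) h1 h3
  have hA : A.det ≠ 0 := by
    intro h0
    have := congrArg Matrix.det hAX
    simp [h0] at this
  have hμ0 : ∀ i, μ i ≠ 0 := by
    have := congrArg Matrix.det hAY
    rw [Matrix.det_mul, Matrix.det_mul, Matrix.det_transpose, Matrix.det_diagonal] at this
    have h4 : ∏ i, μ i ≠ 0 := this ▸ mul_ne_zero (mul_ne_zero hA h2) hA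
    exact fun i => Finset.prod_ne_zero_iff.1 h4 i (Finset.mem_univ i)
  refine ⟨ProjGenLinGroup.mk (Matrix.GeneralLinearGroup.mkOfDetNeZero A hA)⁻¹, μ, hμ, hμ0, ?_⟩
  rw [Subtype.ext_iff, mk_smul_val]
  refine Prod.ext ((transformConic_mk_eq_mk_iff _ _ _).2 ⟨1, one_ne_zero, ?_⟩)
    ((transformConic_mk_eq_mk_iff _ _ _).2 ⟨1, one_ne_zero, ?_⟩)
  · rw [inv_inv, conicMatrix_diagonal, one_smul, Matrix.diagonal_one']
    exact hAX
  · rw [inv_inv, conicMatrix_diagonal, one_smul]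
    exact hAY

/-! ### The slice map and its derivative -/

/-- The infinitesimal form of transversality between the orbit and the diagonal family. By `h1`, `M`
is `a / 2` plus a skew matrix. The diagonal of `h2` reads `w i = (b - a) * d i`, so `w 0 = 0` gives
`b = a` and `w = 0`; off the diagonal it reads `(d i - d j) * M i j = 0`. Fixing the first entry
removes the freedom of rescaling `diag d`. -/
theorem diagonal_and_scalar_of_deformation {M : Matrix (Fin 3) (Fin 3) ℂ} {d w : Fin 3 → ℂ}
    {a b : ℂ} (hd : Function.Injective d) (hd0 : d 0 ≠ 0) (hw : w 0 = 0)
    (h1 : Mᵀ + M = a • 1)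
    (h2 : Mᵀ * Matrix.diagonal d + Matrix.diagonal d * M + Matrix.diagonal w =
      b • Matrix.diagonal d) :
    w = 0 ∧ M = (a / 2) • 1 := by
  have e1 : ∀ i j, M j i + M i j = a * (1 : Matrix (Fin 3) (Fin 3) ℂ) i j := fun i j =>
    congrArg (fun N : Matrix (Fin 3) (Fin 3) ℂ => N i j) h1
  have e2 : ∀ i j, M j i * d j + d i * M i j + Matrix.diagonal w i j =
      b * Matrix.diagonal d i j := fun i j => by
    have := congrArg (fun N : Matrix (Fin 3) (Fin 3) ℂ => N i j) h2
    simpa only [Matrix.add_apply, Matrix.mul_diagonal, Matrix.diagonal_mul, Matrix.transpose_apply,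
      Matrix.smul_apply, smul_eq_mul] using this
  have hdiag : ∀ i, M i i = a / 2 := fun i => by
    have := e1 i i
    rw [Matrix.one_apply_eq] at this
    linear_combination this / 2
  have hw' : ∀ i, w i = (b - a) * d i := fun i => by
    have := e2 i i
    rw [Matrix.diagonal_apply_eq, Matrix.diagonal_apply_eq, hdiag] at this
    linear_combination this
  have hab : b - a = 0 := by
    have := hw' 0
    rw [hw] at this
    exact (mul_eq_zero.1 this.symm).resolve_right hd0
  refine ⟨funext fun i => by rw [hw', hab, zero_mul, Pi.zero_apply], ?_⟩
  ext i j
  rcases eq_or_ne i j with rfl | hij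
  · simp [hdiag]
  · have f1 := e1 i j
    have f2 := e2 i j
    rw [Matrix.one_apply_ne hij] at f1
    rw [Matrix.diagonal_apply_ne _ hij, Matrix.diagonal_apply_ne _ hij] at f2
    have : (d i - d j) * M i j = 0 := by linear_combination f2 - d j * f1
    simp [hij, (mul_eq_zero.1 this).resolve_left (sub_ne_zero.2 (hd.ne hij))]

/-- If the affine coordinates of a curve are stationary, the velocity of the curve is radial. -/
theorem exists_smul_of_hasDerivAt_affine {n : ℕ} (i : Fin (n + 1)) {f : ℂ → Fin (n + 1) → ℂ}
    {f' : Fin (n + 1) → ℂ} {s : ℂ} (hf : HasDerivAt f f' s) (h0 : f s i ≠ 0)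
    (h : HasDerivAt (fun t (k : Fin n) => f t (i.succAbove k) / f t i) 0 s) :
    ∃ c : ℂ, f' = c • f s := by
  rw [hasDerivAt_pi] at hf h
  refine ⟨f' i / f s i, ?_⟩
  ext j
  rw [Pi.smul_apply, smul_eq_mul]
  refine Fin.succAboveCases i ?_ (fun k => ?_) j
  · field_simp
  -- Differentiate the coordinate as quotient times `f i`; the quotient has derivative zero.
  · have h1 := ((h k).mul (hf i)).congr_of_eventuallyEq (f₁ := fun t => f t (i.succAbove k)) (by
      filter_upwards [(hf i).continuousAt.eventually_ne h0] with t ht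
      exact (div_mul_cancel₀ _ ht).symm)
    rw [(hf _).unique h1]
    simp only [Pi.zero_apply]
    field_simp
    ring

section

attribute [local instance] Matrix.linftyOpNormedRing Matrix.linftyOpNormedAlgebra

/-- The derivative of inversion in a Banach algebra; the local norm on matrices only serves to make
this available. -/
theorem hasDerivAt_matrix_inv {A : ℂ → Matrix (Fin 3) (Fin 3) ℂ} {A' : Matrix (Fin 3) (Fin 3) ℂ}
    {s : ℂ} (hA : HasDerivAt A A' s) (h : (A s).det ≠ 0) :
    HasDerivAt (fun t => (A t)⁻¹) (-((A s)⁻¹ * A' * (A s)⁻¹)) s := by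
  obtain ⟨u, hu⟩ := (Matrix.isUnit_iff_isUnit_det _).2 h.isUnit
  have h1 := hasFDerivAt_ringInverse (𝕜 := ℂ) u
  rw [hu] at h1
  have h2 := h1.comp_hasDerivAt s hA
  have hui : (u⁻¹).1 = (A s)⁻¹ := by rw [← hu, Matrix.coe_units_inv]
  simp only [hui, Function.comp_def, ← Matrix.nonsing_inv_eq_ringInverse,
    neg_apply, ContinuousLinearMap.mulLeftRight_apply] at h2
  exact h2

theorem hasDerivAt_congr_mul {B D : ℂ → Matrix (Fin 3) (Fin 3) ℂ}
    {B' D' : Matrix (Fin 3) (Fin 3) ℂ} {s : ℂ} (hB : HasDerivAt B B' s) (hD : HasDerivAt D D' s) :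
    HasDerivAt (fun t => conicCoords ((B t)ᵀ * D t * B t))
      (conicCoords ((B'ᵀ * D s + (B s)ᵀ * D') * B s + (B s)ᵀ * D s * B')) s := by
  have h1 : HasDerivAt (fun t => (B t)ᵀ) B'ᵀ s :=
    (LinearMap.toContinuousLinearMap (Matrix.transposeLinearEquiv (Fin 3) (Fin 3) ℂ
      ℂ).toLinearMap).hasFDerivAt.comp_hasDerivAt s hB
  exact (LinearMap.toContinuousLinearMap conicCoords).hasFDerivAt.comp_hasDerivAt s
    ((h1.mul hD).mul hB)

theorem contDiffAt_congr_mul {E : Type*} [NormedAddCommGroup E] [NormedSpace ℂ E]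
    {A D : E → Matrix (Fin 3) (Fin 3) ℂ} {z : E} (hA : ContDiffAt ℂ ω A z)
    (hD : ContDiffAt ℂ ω D z) (h : (A z).det ≠ 0) :
    ContDiffAt ℂ ω (fun t => conicCoords ((A t)⁻¹ᵀ * D t * (A t)⁻¹)) z := by
  obtain ⟨u, hu⟩ := (Matrix.isUnit_iff_isUnit_det _).2 h.isUnit
  have h1 := contDiffAt_ringInverse ℂ (n := ω) u
  rw [hu] at h1
  have h2 : ContDiffAt ℂ ω (fun t => (A t)⁻¹) z := by
    simpa [Function.comp_def, ← Matrix.nonsing_inv_eq_ringInverse] using h1.comp z hA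
  have h3 : ContDiffAt ℂ ω (fun t => (A t)⁻¹ᵀ) z :=
    (LinearMap.toContinuousLinearMap (Matrix.transposeLinearEquiv (Fin 3) (Fin 3) ℂ
      ℂ).toLinearMap).contDiff.contDiffAt.comp z h2
  exact (LinearMap.toContinuousLinearMap conicCoords).contDiff.contDiffAt.comp z
    ((h3.mul hD).mul h2)

end

/-- The `3 × 3` matrix with affine coordinates `u`, normalized by its `k`-th entry. -/
def affineMatrix (k : Fin (8 + 1)) (u : Fin 8 → ℂ) : Matrix (Fin 3) (Fin 3) ℂ :=
  entries.symm (k.insertNth 1 u)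

/-- The deformation `(l₀, l₁ + v₀, l₂ + v₁)` of the triple `l`. -/
def deform (l : Fin 3 → ℂ) (v : Fin 2 → ℂ) : Fin 3 → ℂ := l + ![0, v 0, v 1]

theorem deform_zero (l : Fin 3 → ℂ) : deform l 0 = l := by
  ext i
  fin_cases i <;> simp [deform]

theorem deform_injective (l : Fin 3 → ℂ) : Function.Injective (deform l) := by
  intro v w h
  have h' := add_left_cancel h
  ext i
  fin_cases i
  · exact congrFun h' 1
  · exact congrFun h' 2

theorem continuous_deform (l : Fin 3 → ℂ) : Continuous (deform l) := by
  refine continuous_const.add (continuous_pi fun i => ?_)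
  fin_cases i
  · exact continuous_const
  · exact continuous_apply 0
  · exact continuous_apply 1

/-- Coordinates of the conic `A⁻¹ᵀ (diag d) A⁻¹`. -/
def movedConic (k : Fin (8 + 1)) (u : Fin 8 → ℂ) (d : Fin 3 → ℂ) : Fin (5 + 1) → ℂ :=
  conicCoords ((affineMatrix k u)⁻¹ᵀ * Matrix.diagonal d * (affineMatrix k u)⁻¹)

/-- The map `(A, v) ↦ A • (I₃, diag (deform l v))` in affine coordinates. -/
def sliceMap (l : Fin 3 → ℂ) (k : Fin (8 + 1)) (i j : Fin (5 + 1))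
    (z : (Fin 8 → ℂ) × (Fin 2 → ℂ)) : (Fin 5 → ℂ) × (Fin 5 → ℂ) :=
  (fun a => movedConic k z.1 1 (i.succAbove a) / movedConic k z.1 1 i,
    fun a => movedConic k z.1 (deform l z.2) (j.succAbove a) / movedConic k z.1 (deform l z.2) j)

/-- Points at which the slice map is a regular parametrization. -/
def sliceDomain (l : Fin 3 → ℂ) (k : Fin (8 + 1)) (i j : Fin (5 + 1)) (T : Set (Fin 8 → ℂ))
    (W : Set (Fin 2 → ℂ)) : Set ((Fin 8 → ℂ) × (Fin 2 → ℂ)) :=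
  {z | z.1 ∈ T ∧ z.2 ∈ W ∧ Function.Injective (deform l z.2) ∧ (∀ a, deform l z.2 a ≠ 0) ∧
    movedConic k z.1 1 i ≠ 0 ∧ movedConic k z.1 (deform l z.2) j ≠ 0}

section

attribute [local instance] Matrix.linftyOpNormedRing Matrix.linftyOpNormedAlgebra

theorem contDiff_affineMatrix (k : Fin (8 + 1)) : ContDiff ℂ ω (affineMatrix k) := by
  refine (LinearMap.toContinuousLinearMap entries.symm.toLinearMap).contDiff.comp
    (contDiff_pi.2 fun a => ?_)
  refine Fin.succAboveCases k ?_ (fun b => ?_) a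
  · simpa using contDiff_const
  · simpa using contDiff_apply ℂ ℂ b

theorem contDiff_diagonal_deform (l : Fin 3 → ℂ) :
    ContDiff ℂ ω fun v => Matrix.diagonal (deform l v) := by
  have h : ContDiff ℂ ω (deform l) := by
    refine contDiff_pi.2 fun a => ?_
    fin_cases a
    · exact contDiff_const (c := l 0 + 0)
    · exact ContDiff.add (f := fun _ => l 1) contDiff_const (contDiff_apply ℂ ℂ 0)
    · exact ContDiff.add (f := fun _ => l 2) contDiff_const (contDiff_apply ℂ ℂ 1)
  exact (LinearMap.toContinuousLinearMap (Matrix.diagonalLinearMap (Fin 3) ℂ ℂ)).contDiff.comp h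

theorem contDiffAt_movedConic_one {k : Fin (8 + 1)} {z : (Fin 8 → ℂ) × (Fin 2 → ℂ)}
    (h : (affineMatrix k z.1).det ≠ 0) :
    ContDiffAt ℂ ω (fun z : (Fin 8 → ℂ) × (Fin 2 → ℂ) => movedConic k z.1 1) z :=
  contDiffAt_congr_mul (A := fun z : (Fin 8 → ℂ) × (Fin 2 → ℂ) => affineMatrix k z.1)
    (D := fun _ => Matrix.diagonal 1)
    ((contDiff_affineMatrix k).comp contDiff_fst).contDiffAt contDiffAt_const h

theorem contDiffAt_movedConic (l : Fin 3 → ℂ) {k : Fin (8 + 1)} {z : (Fin 8 → ℂ) × (Fin 2 → ℂ)}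
    (h : (affineMatrix k z.1).det ≠ 0) :
    ContDiffAt ℂ ω (fun z : (Fin 8 → ℂ) × (Fin 2 → ℂ) => movedConic k z.1 (deform l z.2)) z :=
  contDiffAt_congr_mul (A := fun z : (Fin 8 → ℂ) × (Fin 2 → ℂ) => affineMatrix k z.1)
    (D := fun z => Matrix.diagonal (deform l z.2))
    ((contDiff_affineMatrix k).comp contDiff_fst).contDiffAt
    ((contDiff_diagonal_deform l).comp contDiff_snd).contDiffAt h

variable {l : Fin 3 → ℂ} {k : Fin (8 + 1)} {i j : Fin (5 + 1)} {T : Set (Fin 8 → ℂ)}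
  {W : Set (Fin 2 → ℂ)} {z : (Fin 8 → ℂ) × (Fin 2 → ℂ)}

theorem contDiffAt_sliceMap (hT : ∀ u ∈ T, (affineMatrix k u).det ≠ 0)
    (hz : z ∈ sliceDomain l k i j T W) : ContDiffAt ℂ ω (sliceMap l k i j) z := by
  obtain ⟨h1, -, -, -, h2, h3⟩ := hz
  have e1 := contDiffAt_pi.1 (contDiffAt_movedConic_one (hT _ h1))
  have e2 := contDiffAt_pi.1 (contDiffAt_movedConic l (hT _ h1))
  exact (contDiffAt_pi.2 fun a => (e1 _).div (e1 i) h2).prodMk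
    (contDiffAt_pi.2 fun a => (e2 _).div (e2 j) h3)

theorem isOpen_sliceDomain (hTo : IsOpen T) (hWo : IsOpen W)
    (hT : ∀ u ∈ T, (affineMatrix k u).det ≠ 0) : IsOpen (sliceDomain l k i j T W) := by
  rw [isOpen_iff_mem_nhds]
  intro z hz
  obtain ⟨h1, h2, h3, h4, h5, h6⟩ := hz
  have hd : Continuous fun z : (Fin 8 → ℂ) × (Fin 2 → ℂ) => deform l z.2 :=
    (continuous_deform l).comp continuous_snd
  have hda := continuous_pi_iff.1 hd
  have e1 := continuousAt_pi.1 (contDiffAt_movedConic_one (hT _ h1)).continuousAt i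
  have e2 := continuousAt_pi.1 (contDiffAt_movedConic l (hT _ h1)).continuousAt j
  have h3' : ∀ᶠ z in 𝓝 z, ∀ a b, a ≠ b → deform l z.2 a ≠ deform l z.2 b := by
    refine Filter.eventually_all.2 fun a => Filter.eventually_all.2 fun b => ?_
    by_cases hab : a = b
    · simp [hab]
    · have : deform l z.2 a - deform l z.2 b ≠ 0 := sub_ne_zero.2 (h3.ne hab)
      filter_upwards [((hda a).sub (hda b)).continuousAt.eventually_ne this] with y hy _
      exact sub_ne_zero.1 hy
  filter_upwards [(hTo.preimage continuous_fst).mem_nhds h1,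
    (hWo.preimage continuous_snd).mem_nhds h2, h3',
    Filter.eventually_all.2 fun a => (hda a).continuousAt.eventually_ne (h4 a),
    e1.eventually_ne h5, e2.eventually_ne h6] with y y1 y2 y3 y4 y5 y6
  exact ⟨y1, y2, fun a b => not_imp_not.1 (y3 a b), y4, y5, y6⟩

theorem hasDerivAt_line {E : Type*} [NormedAddCommGroup E] [NormedSpace ℂ E] (a b : E) (s : ℂ) :
    HasDerivAt (fun t : ℂ => a + t • b) b s := by
  simpa using ((hasDerivAt_id s).smul_const b).const_add a

theorem affineMatrix_add_smul (k : Fin (8 + 1)) (u h : Fin 8 → ℂ) (t : ℂ) :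
    affineMatrix k (u + t • h) = affineMatrix k u + t • entries.symm (k.insertNth 0 h) := by
  rw [affineMatrix, affineMatrix, ← map_smul, ← map_add]
  congr 1
  ext a
  refine Fin.succAboveCases k ?_ (fun b => ?_) a
  · simp
  · simp

theorem diagonal_deform_add_smul (l : Fin 3 → ℂ) (v w : Fin 2 → ℂ) (t : ℂ) :
    Matrix.diagonal (deform l (v + t • w)) =
      Matrix.diagonal (deform l v) + t • Matrix.diagonal ![0, w 0, w 1] := by
  ext a b
  rcases eq_or_ne a b with rfl | hab
  · fin_cases a <;> simp [deform, add_assoc]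
  · simp [hab]

/-- Cancelling the matrix `B` from an infinitesimal congruence of `D` by `-(B H B)`. -/
theorem congr_cancel {A H D D' : Matrix (Fin 3) (Fin 3) ℂ} {c : ℂ} (hA : A.det ≠ 0)
    (hD : Dᵀ = D) (hD' : D'ᵀ = D')
    (h : conicCoords (((-(A⁻¹ * H * A⁻¹))ᵀ * D + A⁻¹ᵀ * D') * A⁻¹ +
      A⁻¹ᵀ * D * (-(A⁻¹ * H * A⁻¹))) = c • conicCoords (A⁻¹ᵀ * D * A⁻¹)) :
    (-(A⁻¹ * H))ᵀ * D + D * (-(A⁻¹ * H)) + D' = c • D := by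
  have hs : A⁻¹ᵀ * ((-(A⁻¹ * H))ᵀ * D + D * (-(A⁻¹ * H)) + D') * A⁻¹ = A⁻¹ᵀ * (c • D) * A⁻¹ := by
    have hl : ((-(A⁻¹ * H * A⁻¹))ᵀ * D + A⁻¹ᵀ * D') * A⁻¹ + A⁻¹ᵀ * D * (-(A⁻¹ * H * A⁻¹)) =
        A⁻¹ᵀ * ((-(A⁻¹ * H))ᵀ * D + D * (-(A⁻¹ * H)) + D') * A⁻¹ := by
      rw [← Matrix.neg_mul, Matrix.transpose_mul]
      noncomm_ring
    rw [hl, ← map_smul] at h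
    -- Both sides are symmetric matrices, hence determined by their coordinates; the symmetry is
    -- checked in the two side goals below.
    have h' := congrArg conicMatrix h
    rw [conicMatrix_conicCoords, conicMatrix_conicCoords] at h'
    · rw [h', Matrix.mul_smul, Matrix.smul_mul]
    · simp [Matrix.transpose_mul, hD, mul_assoc]
    · simp only [Matrix.transpose_mul, Matrix.transpose_add, Matrix.transpose_transpose, hD, hD',
        mul_assoc]
      rw [add_comm (D * _)]
  have h1 : A⁻¹ * A = 1 := Matrix.nonsing_inv_mul _ hA.isUnit
  have h2 : Aᵀ * A⁻¹ᵀ = 1 := by rw [← Matrix.transpose_mul, h1, Matrix.transpose_one]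
  have h3 := congrArg (fun M => Aᵀ * M * A) hs
  simpa only [← mul_assoc, h2, one_mul, mul_assoc _ A⁻¹ A, h1, mul_one] using h3

/-- For `(h, w)` in the kernel, the homogeneous coordinates of both conics have radial velocity
along the line in direction `(h, w)`. After cancelling `A⁻¹` this becomes the system of
`diagonal_and_scalar_of_deformation` with `M = -A⁻¹ H`. So `w = 0` and `H` is a multiple of `A`,
which the normalization of the chart reduces to `H = 0`. -/
theorem fderiv_sliceMap_injective (hT : ∀ u ∈ T, (affineMatrix k u).det ≠ 0)
    (hz : z ∈ sliceDomain l k i j T W) :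
    Function.Injective (fderiv ℂ (sliceMap l k i j) z) := by
  rw [injective_iff_map_eq_zero]
  rintro ⟨h, w⟩ h0
  have hF := ((contDiffAt_sliceMap hT hz).differentiableAt (by simp)).hasFDerivAt
  have hline := hasDerivAt_line z (h, w) 0
  have hF' : HasFDerivAt (sliceMap l k i j) (fderiv ℂ (sliceMap l k i j) z)
      (z + (0 : ℂ) • (h, w)) := by simpa using hF
  have hg := hF'.comp_hasDerivAt 0 hline
  rw [h0] at hg
  have hg1 := (hasFDerivAt_fst (𝕜 := ℂ)
    (p := sliceMap l k i j (z + (0 : ℂ) • (h, w)))).comp_hasDerivAt 0 hg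
  have hg2 := (hasFDerivAt_snd (𝕜 := ℂ)
    (p := sliceMap l k i j (z + (0 : ℂ) • (h, w)))).comp_hasDerivAt 0 hg
  obtain ⟨h1, -, h3, h4, h5, h6⟩ := hz
  have hdet := hT _ h1
  set A := affineMatrix k z.1 with hA
  set H := entries.symm (k.insertNth 0 h : Fin (8 + 1) → ℂ) with hH
  have dA : HasDerivAt (fun t : ℂ => (affineMatrix k (z.1 + t • h))⁻¹) (-(A⁻¹ * H * A⁻¹)) 0 := by
    have e1 : HasDerivAt (fun t : ℂ => affineMatrix k (z.1 + t • h)) H 0 := by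
      simp only [affineMatrix_add_smul]
      exact hasDerivAt_line _ _ _
    have := hasDerivAt_matrix_inv e1 (by simpa using hdet)
    simpa only [zero_smul, add_zero] using this
  have dD : HasDerivAt (fun t : ℂ => Matrix.diagonal (deform l (z.2 + t • w)))
      (Matrix.diagonal ![0, w 0, w 1]) 0 := by
    simp only [diagonal_deform_add_smul]
    exact hasDerivAt_line _ _ _
  have d1 := hasDerivAt_congr_mul dA (hasDerivAt_const (0 : ℂ) (Matrix.diagonal (1 : Fin 3 → ℂ)))
  have d2 := hasDerivAt_congr_mul dA dD
  obtain ⟨a, ha⟩ := exists_smul_of_hasDerivAt_affine i d1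
    (by simp only [zero_smul, add_zero]; exact h5) hg1
  obtain ⟨b, hb⟩ := exists_smul_of_hasDerivAt_affine j d2
    (by simp only [zero_smul, add_zero]; exact h6) hg2
  simp only [zero_smul, add_zero] at ha hb
  have r1 := congr_cancel hdet (Matrix.diagonal_transpose _) Matrix.transpose_zero ha
  have r2 := congr_cancel hdet (Matrix.diagonal_transpose _) (Matrix.diagonal_transpose _) hb
  rw [Matrix.diagonal_one', mul_one, one_mul, add_zero] at r1
  obtain ⟨s1, s2⟩ := diagonal_and_scalar_of_deformation h3 (h4 0) rfl r1 r2
  have s3 : H = (-(a / 2)) • A := by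
    have := congrArg (fun M => -(A * M)) s2
    simp only [mul_neg, neg_neg, ← mul_assoc, Matrix.mul_nonsing_inv _ hdet.isUnit, one_mul,
      Matrix.mul_smul, mul_one] at this
    rw [this, neg_smul]
  have s4 : (k.insertNth 0 h : Fin (8 + 1) → ℂ) = (-(a / 2)) • (k.insertNth 1 z.1) := by
    apply entries.symm.injective
    rw [map_smul]
    exact s3
  have s5 : -(a / 2) = 0 := by
    -- The `k`-th entry is constantly `1` in the chart, so its variation is `0`: the factor must
    -- vanish.
    have := congrFun s4 k
    simpa using this.symm
  rw [s5, zero_smul] at s4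
  refine Prod.ext (funext fun b => ?_) (funext fun b => ?_)
  · simpa using congrFun s4 (k.succAbove b)
  · fin_cases b
    · exact congrFun s1 1
    · exact congrFun s1 2

end

/-- The inverse function theorem. The source is cut down to `sliceDomain`, where the derivative is
bijective at every point, so that the inverse is analytic on the whole target and not only near the
image of `z`. -/
theorem exists_sliceHomeomorph {l : Fin 3 → ℂ} {k : Fin (8 + 1)} {i j : Fin (5 + 1)}
    {T : Set (Fin 8 → ℂ)} {W : Set (Fin 2 → ℂ)} {z : (Fin 8 → ℂ) × (Fin 2 → ℂ)}
    (hTo : IsOpen T) (hWo : IsOpen W) (hT : ∀ u ∈ T, (affineMatrix k u).det ≠ 0)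
    (hz : z ∈ sliceDomain l k i j T W) :
    ∃ Θ : OpenPartialHomeomorph ((Fin 8 → ℂ) × (Fin 2 → ℂ)) ((Fin 5 → ℂ) × (Fin 5 → ℂ)),
      z ∈ Θ.source ∧ Θ.source ⊆ sliceDomain l k i j T W ∧ (∀ y, Θ y = sliceMap l k i j y) ∧
      ContDiffOn ℂ ω Θ Θ.source ∧ ContDiffOn ℂ ω Θ.symm Θ.target := by
  have hequiv : ∀ y ∈ sliceDomain l k i j T W,
      ∃ e : ((Fin 8 → ℂ) × (Fin 2 → ℂ)) ≃L[ℂ] ((Fin 5 → ℂ) × (Fin 5 → ℂ)),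
        HasFDerivAt (sliceMap l k i j) (e : _ →L[ℂ] _) y := by
    intro y hy
    let e := LinearMap.linearEquivOfInjective (fderiv ℂ (sliceMap l k i j) y).toLinearMap
      (fderiv_sliceMap_injective hT hy) (by simp)
    refine ⟨e.toContinuousLinearEquiv,
      ((contDiffAt_sliceMap hT hy).differentiableAt (by simp)).hasFDerivAt.congr_fderiv ?_⟩
    exact ContinuousLinearMap.ext fun _ => rfl
  obtain ⟨e, he⟩ := hequiv z hz
  let Θ₀ := (contDiffAt_sliceMap hT hz).toOpenPartialHomeomorph _ he (by simp)
  have hO := isOpen_sliceDomain (l := l) (i := i) (j := j) hTo hWo hT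
  refine ⟨Θ₀.restrOpen _ hO,
    ⟨(contDiffAt_sliceMap hT hz).mem_toOpenPartialHomeomorph_source he (by simp), hz⟩,
    fun y hy => hy.2, fun y => rfl, fun y hy => (contDiffAt_sliceMap hT hy.2).contDiffWithinAt,
    fun y hy => ?_⟩
  have hy' := (Θ₀.restrOpen _ hO).map_target hy
  obtain ⟨e', he'⟩ := hequiv _ hy'.2
  exact ((Θ₀.restrOpen _ hO).contDiffAt_symm hy he'
    (contDiffAt_sliceMap hT hy'.2)).contDiffWithinAt

/-! ### Slices in the charts of `PGL(3, ℂ)` and of the space of pairs -/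

/-- The affine chart of `PGL(3, ℂ)` where the `k`-th entry does not vanish. -/
def pglChart (k : Fin (8 + 1)) : OpenPartialHomeomorph PGL(3, ℂ) (Fin 8 → ℂ) :=
  (isOpenEmbedding_pglToCP.toOpenPartialHomeomorph pglToCP).trans (affineChart k)

theorem exists_chartAt_eq_pglChart (g : PGL(3, ℂ)) :
    ∃ k, chartAt (Fin 8 → ℂ) g = pglChart k := ⟨_, rfl⟩

theorem exists_pglChart_symm_eq {k : Fin (8 + 1)} {u : Fin 8 → ℂ} (hu : u ∈ (pglChart k).target) :
    ∃ A : GL (Fin 3) ℂ, A.1 = affineMatrix k u ∧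
      (pglChart k).symm u = ProjGenLinGroup.mk A := by
  have h : pglToCP ((pglChart k).symm u) =
      Projectivization.mk ℂ (k.insertNth 1 u) (insertNth_ne_zero k u) := by
    refine (isOpenEmbedding_pglToCP.toOpenPartialHomeomorph pglToCP).right_inv ?_
    have : u ∈ ((isOpenEmbedding_pglToCP.toOpenPartialHomeomorph pglToCP).trans
      (affineChart k)).target := hu
    rw [OpenPartialHomeomorph.trans_target] at this
    exact this.2
  obtain ⟨B, hB⟩ := ProjGenLinGroup.mk_surjective ((pglChart k).symm u)
  rw [← hB, pglToCP_mk, Projectivization.mk_eq_mk_iff] at h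
  obtain ⟨c, hc⟩ := h
  -- Rescale an arbitrary representative so that its `k`-th entry becomes `1`.
  refine ⟨B * Matrix.GeneralLinearGroup.scalar (Fin 3) c⁻¹, ?_, ?_⟩
  · apply entries.injective
    rw [affineMatrix, LinearEquiv.apply_symm_apply]
    have : (B * Matrix.GeneralLinearGroup.scalar (Fin 3) c⁻¹).1 = (c⁻¹ : ℂˣ) • B.1 := by
      ext i j
      rw [mul_scalar_apply, Matrix.smul_apply, Units.smul_def, smul_eq_mul, mul_comm]
    rw [this, Units.smul_def, map_smul, ← hc, Units.smul_def, smul_smul, ← Units.val_mul,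
      inv_mul_cancel, Units.val_one, one_smul]
  · rw [map_mul, ProjGenLinGroup.mk_scalar, mul_one, hB]

theorem det_affineMatrix_ne_zero {k : Fin (8 + 1)} {u : Fin 8 → ℂ}
    (hu : u ∈ (pglChart k).target) : (affineMatrix k u).det ≠ 0 := by
  obtain ⟨A, hA, -⟩ := exists_pglChart_symm_eq hu
  rw [← hA]
  exact ((Matrix.isUnit_iff_isUnit_det _).1 A.isUnit).ne_zero

theorem transform_eq_movedConic {k : Fin (8 + 1)} {u : Fin 8 → ℂ} {A : GL (Fin 3) ℂ}
    (hA : A.1 = affineMatrix k u) (m : Fin 3 → ℂ) :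
    transform A (conicCoords (Matrix.diagonal m)) = movedConic k u m := by
  rw [movedConic, ← hA, ← Matrix.coe_units_inv, ← conicMatrix_diagonal m, ← conicMatrix_transform,
    conicCoords_conicMatrix (transform _ _), conicMatrix_diagonal]

theorem smul_diagPair_val {k : Fin (8 + 1)} {u : Fin 8 → ℂ} (hu : u ∈ (pglChart k).target)
    {m : Fin 3 → ℂ} (hm : Function.Injective m) (hm0 : ∀ a, m a ≠ 0) :
    ∃ (h1 : movedConic k u 1 ≠ 0) (h2 : movedConic k u m ≠ 0),
      ((pglChart k).symm u • diagPair m hm hm0).1 =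
        (Projectivization.mk ℂ _ h1, Projectivization.mk ℂ _ h2) := by
  obtain ⟨A, hA, hA'⟩ := exists_pglChart_symm_eq hu
  have hne : ∀ m : Fin 3 → ℂ, m 0 ≠ 0 → movedConic k u m ≠ 0 := fun m hm => by
    rw [← transform_eq_movedConic hA, map_ne_zero_iff _ (transform_injective A)]
    exact conicCoords_diagonal_ne_zero hm
  refine ⟨hne _ one_ne_zero, hne _ (hm0 0), ?_⟩
  rw [hA', mk_smul_val]
  simp only [← transform_eq_movedConic hA]
  rfl

theorem exists_chartAt_pairs (x : pairs) : ∃ i j : Fin (5 + 1),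
    (∀ y : pairs, chartAt (ModelProd (Fin 5 → ℂ) (Fin 5 → ℂ)) x y =
      (affineChart i y.1.1, affineChart j y.1.2)) ∧
    ∀ y : pairs, y ∈ (chartAt (ModelProd (Fin 5 → ℂ) (Fin 5 → ℂ)) x).source ↔
      y.1.1 ∈ affineSet i ∧ y.1.2 ∈ affineSet j := by
  refine ⟨(exists_mem_affineSet x.1.1).choose, (exists_mem_affineSet x.1.2).choose,
    fun y => rfl, fun y => ?_⟩
  rw [TopologicalSpace.Opens.chartAt_eq, OpenPartialHomeomorph.subtypeRestr_source]
  rfl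

/-- By monomiality the deformed triple is `l ∘ τ` divided by a factor `t`. The undeformed first
entry gives `t = l (τ 0) / l 0`, so the triple is determined by the permutation `τ`. -/
theorem finite_deform_mem_orbit {l : Fin 3 → ℂ} (hl : Function.Injective l) (hl0 : ∀ a, l a ≠ 0) :
    {v : Fin 2 → ℂ | ∃ (h : Function.Injective (deform l v)) (h0 : ∀ a, deform l v a ≠ 0),
      diagPair _ h h0 ∈ orbit (diagPair l hl hl0)}.Finite := by
  refine Set.Finite.subset (Set.Finite.preimage (deform_injective l).injOn
    (Set.finite_range fun τ : Equiv.Perm (Fin 3) => fun a => l (τ a) * (l 0 / l (τ 0)))) ?_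
  rintro v ⟨h, h0, g, hg⟩
  induction g using ProjGenLinGroup.induction_on with | mk g => ?_
  obtain ⟨⟨c, hc, h1⟩, d, hd, h2⟩ := (smul_diagPair_eq_iff g hl hl0 h h0).1 hg
  obtain ⟨τ, -, -, t, ht, h3⟩ := exists_perm_of_congr hl h hc hd h1 h2
  refine ⟨τ, funext fun a => ?_⟩
  have h4 : deform l v 0 = l 0 := by simp [deform]
  have h5 := h3 0
  have h6 := hl0 0
  rw [h4] at h5
  simp only
  rw [h5, h3 a]
  field_simp

theorem diagPair_congr {l m : Fin 3 → ℂ} (h : l = m) (hl : Function.Injective l)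
    (hl0 : ∀ a, l a ≠ 0) (hm : Function.Injective m) (hm0 : ∀ a, m a ≠ 0) :
    diagPair l hl hl0 = diagPair m hm hm0 := by
  subst h
  rfl

/-- Around a point of the orbit of `diagPair l` the space of pairs is a product of an open subset
of `PGL(3, ℂ)` and a transversal that meets the orbit once. -/
theorem exists_slice {l : Fin 3 → ℂ} (hl : Function.Injective l) (hl0 : ∀ a, l a ≠ 0)
    (g : PGL(3, ℂ)) {x : pairs} (hx : g • diagPair l hl hl0 = x) :
    ∃ Θ : OpenPartialHomeomorph ((Fin 8 → ℂ) × (Fin 2 → ℂ)) ((Fin 5 → ℂ) × (Fin 5 → ℂ)),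
      (chartAt (Fin 8 → ℂ) g g, 0) ∈ Θ.source ∧ ContDiffOn ℂ ω Θ Θ.source ∧
      ContDiffOn ℂ ω Θ.symm Θ.target ∧
      ∀ z ∈ Θ.source, z.1 ∈ (chartAt (Fin 8 → ℂ) g).target ∧
        ∃ (h : Function.Injective (deform l z.2)) (h0 : ∀ a, deform l z.2 a ≠ 0),
          (chartAt (Fin 8 → ℂ) g).symm z.1 • diagPair _ h h0 ∈
            (chartAt (ModelProd (Fin 5 → ℂ) (Fin 5 → ℂ)) x).source ∧
          chartAt (ModelProd (Fin 5 → ℂ) (Fin 5 → ℂ)) x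
            ((chartAt (Fin 8 → ℂ) g).symm z.1 • diagPair _ h h0) = Θ z ∧
          ((chartAt (Fin 8 → ℂ) g).symm z.1 • diagPair _ h h0 ∈ orbit (diagPair l hl hl0) →
            z.2 = 0) := by
  have hg : chartAt (Fin 8 → ℂ) g g ∈ (chartAt (Fin 8 → ℂ) g).target :=
    (chartAt (Fin 8 → ℂ) g).map_source (mem_chart_source _ g)
  have hg' : (chartAt (Fin 8 → ℂ) g).symm (chartAt (Fin 8 → ℂ) g g) = g :=
    (chartAt (Fin 8 → ℂ) g).left_inv (mem_chart_source _ g)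
  have hxs := mem_chart_source (ModelProd (Fin 5 → ℂ) (Fin 5 → ℂ)) x
  obtain ⟨k, hk⟩ := exists_chartAt_eq_pglChart g
  obtain ⟨i, j, hc, hs⟩ := exists_chartAt_pairs x
  rw [hk] at hg hg'
  rw [hk]
  set S := {v : Fin 2 → ℂ | ∃ (h : Function.Injective (deform l v))
    (h0 : ∀ a, deform l v a ≠ 0), diagPair _ h h0 ∈ orbit (diagPair l hl hl0)} with hS
  -- Removing the finitely many other parameters whose pair lies in the orbit leaves an open
  -- neighbourhood of `0`.
  have hWo : IsOpen (S \ {0})ᶜ :=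
    ((finite_deform_mem_orbit hl hl0).subset Set.sdiff_subset).isClosed.isOpen_compl
  have hz : (pglChart k g, (0 : Fin 2 → ℂ)) ∈
      sliceDomain l k i j (pglChart k).target (S \ {0})ᶜ := by
    rw [hs, ← hx] at hxs
    obtain ⟨h1, h2, h3⟩ := smul_diagPair_val hg hl hl0
    rw [hg'] at h3
    rw [h3] at hxs
    simp only [mk_mem_affineSet] at hxs
    refine ⟨hg, by simp, ?_, ?_, hxs.1, ?_⟩ <;> simp only [deform_zero]
    exacts [hl, hl0, hxs.2]
  obtain ⟨Θ, h1, h2, h3, h4, h5⟩ := exists_sliceHomeomorph (pglChart k).open_target hWo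
    (fun u hu => det_affineMatrix_ne_zero hu) hz
  refine ⟨Θ, h1, h4, h5, fun z hz => ?_⟩
  obtain ⟨e1, e2, e3, e4, e5, e6⟩ := h2 hz
  obtain ⟨f1, f2, f3⟩ := smul_diagPair_val e1 e3 e4
  refine ⟨e1, e3, e4, ?_, ?_, fun ho => ?_⟩
  · rw [hs, f3]
    exact ⟨(mk_mem_affineSet _).2 e5, (mk_mem_affineSet _).2 e6⟩
  · rw [hc, f3, h3]
    rfl
  · by_contra hne
    exact e2 ⟨⟨e3, e4, MulAction.orbit_eq_iff.1
      ((MulAction.orbit_smul _ _).symm.trans (MulAction.orbit_eq_iff.2 ho))⟩, hne⟩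

/-! ### The orbit map -/

theorem continuous_transformConic (c : CP 5) :
    Continuous fun g : GL (Fin 3) ℂ => transformConic g c := by
  induction c using Projectivization.ind with | h x hx => ?_
  have h1 : Continuous fun g : GL (Fin 3) ℂ => g⁻¹.1 := Units.continuous_val.comp continuous_inv
  have h2 : Continuous fun g : GL (Fin 3) ℂ => transform g x :=
    (LinearMap.continuous_of_finiteDimensional conicCoords).comp
      (h1.matrix_transpose.matrix_mul (continuous_const.matrix_mul h1))
  exact (isOpenQuotientMap_mk 5).continuous.comp
    (h2.subtype_mk fun g => (map_ne_zero_iff _ (transform_injective g)).2 hx)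

theorem continuous_smul_pairs (p : pairs) : Continuous fun g : PGL(3, ℂ) => g • p := by
  have hq : IsQuotientMap (ProjGenLinGroup.mk : GL (Fin 3) ℂ → PGL(3, ℂ)) :=
    isQuotientMap_quotient_mk'
  rw [hq.continuous_iff]
  exact ((continuous_transformConic p.1.1).prodMk (continuous_transformConic p.1.2)).subtype_mk _

/-- This makes the quotient topology on an orbit agree with the subspace topology. A pair close to
`x` has slice coordinates `(u, v)` close to those of `x`; if it lies in the orbit then `v = 0`, so
it is the image of a group element close to `g`. -/
theorem isOpenMap_orbitMap {l : Fin 3 → ℂ} (hl : Function.Injective l) (hl0 : ∀ a, l a ≠ 0) :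
    IsOpenMap fun g : PGL(3, ℂ) =>
      (⟨g • diagPair l hl hl0, MulAction.mem_orbit _ _⟩ : orbit (diagPair l hl hl0)) := by
  rw [isOpenMap_iff_nhds_le]
  intro g V hV
  rw [Filter.mem_map] at hV
  set e := chartAt (Fin 8 → ℂ) g with he
  set x := g • diagPair l hl hl0 with hx
  set ψ := chartAt (ModelProd (Fin 5 → ℂ) (Fin 5 → ℂ)) x with hψ
  obtain ⟨Θ, h1, -, -, h2⟩ := exists_slice hl hl0 g hx.symm
  have hxs : x ∈ ψ.source := mem_chart_source _ x
  -- the points of the product that come from the given neighbourhood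
  have hO : Θ.source ∩ {z | e.symm z.1 • diagPair l hl hl0 ∈ Subtype.val '' V} ∈
      𝓝 (e g, (0 : Fin 2 → ℂ)) := by
    refine Filter.inter_mem (Θ.open_source.mem_nhds h1) ?_
    have hc : Filter.Tendsto (fun z : (Fin 8 → ℂ) × (Fin 2 → ℂ) => e.symm z.1)
        (𝓝 (e g, (0 : Fin 2 → ℂ))) (𝓝 g) := by
      have h3 := e.continuousAt_symm (e.map_source (mem_chart_source _ g))
      rw [ContinuousAt, e.left_inv (mem_chart_source _ g)] at h3
      exact h3.comp continuousAt_fst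
    filter_upwards [hc hV] with z hz
    exact ⟨_, hz, rfl⟩
  have hΘ0 : Θ (e g, 0) = ψ x := by
    obtain ⟨-, h, h0, -, h3, -⟩ := h2 _ h1
    rw [← h3]
    rw [diagPair_congr (deform_zero l) h h0 hl hl0]
    exact congrArg (fun a => ψ (a • diagPair l hl hl0)) (e.left_inv (mem_chart_source _ g))
  have himg := Θ.image_mem_nhds h1 hO
  rw [hΘ0] at himg
  have hpre := (ψ.continuousAt hxs).preimage_mem_nhds himg
  have hpre2 : (Subtype.val : orbit (diagPair l hl hl0) → pairs) ⁻¹' (ψ.source ∩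
      ψ ⁻¹' (Θ '' (Θ.source ∩ {z | e.symm z.1 • diagPair l hl hl0 ∈ Subtype.val '' V}))) ∈
      𝓝 (⟨x, MulAction.mem_orbit _ _⟩ : orbit (diagPair l hl hl0)) :=
    continuous_subtype_val.continuousAt.preimage_mem_nhds
      (Filter.inter_mem (ψ.open_source.mem_nhds hxs) hpre)
  refine Filter.mem_of_superset hpre2 ?_
  rintro ⟨y, hy⟩ ⟨hys, z, ⟨hz, hzV⟩, hzy⟩
  obtain ⟨-, h, h0, h3, h4, h5⟩ := h2 z hz
  have hyz : e.symm z.1 • diagPair _ h h0 = y := ψ.injOn h3 hys (h4.trans hzy)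
  have hz0 := h5 (by rw [hyz]; exact hy)
  rw [diagPair_congr (by rw [hz0, deform_zero]) h h0 hl hl0] at hyz
  obtain ⟨w, hw, hwy⟩ := hzV
  have : (⟨y, hy⟩ : orbit (diagPair l hl hl0)) = w := Subtype.ext (hyz.symm.trans hwy.symm)
  rw [this]
  exact hw

/-! ### Transport of charts along a homeomorphism -/

section Transport

variable {H X Y : Type*} [TopologicalSpace H] [TopologicalSpace X] [TopologicalSpace Y]
  [ChartedSpace H Y]

/-- The charts of `Y` transported to `X` along a homeomorphism. -/
@[reducible] def transportedChartedSpace (Φ : X ≃ₜ Y) : ChartedSpace H X where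
  atlas := (fun e => Φ.transOpenPartialHomeomorph e) '' atlas H Y
  chartAt x := Φ.transOpenPartialHomeomorph (chartAt H (Φ x))
  mem_chart_source x := mem_chart_source H (Φ x)
  chart_mem_atlas x := ⟨_, chart_mem_atlas H (Φ x), rfl⟩

variable {E : Type*} [NormedAddCommGroup E] [NormedSpace ℂ E] {I : ModelWithCorners ℂ E H}

/-- The homeomorphism cancels in the transition maps, which are those of `Y`. -/
theorem isManifold_transported [hY : IsManifold I ω Y] (Φ : X ≃ₜ Y) :
    letI := transportedChartedSpace (H := H) Φ
    IsManifold I ω X := by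
  let _ := transportedChartedSpace (H := H) Φ
  refine { compatible := ?_ }
  rintro _ _ ⟨e, he, rfl⟩ ⟨e', he', rfl⟩
  have h : (Φ.transOpenPartialHomeomorph e).symm.trans (Φ.transOpenPartialHomeomorph e') =
      e.symm.trans e' := by
    ext y
    · simp
    · simp
    · simp
  rw [h]
  exact HasGroupoid.compatible he he'

/-- The homeomorphism is an isomorphism onto `Y` for the transported charts. -/
def transportedDiffeomorph [IsManifold I ω Y] (Φ : X ≃ₜ Y) :
    letI := transportedChartedSpace (H := H) Φ
    Diffeomorph I I X Y ω :=
  letI := transportedChartedSpace (H := H) Φ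
  haveI : IsManifold I ω X := isManifold_transported Φ
  { toEquiv := Φ.toEquiv
    contMDiff_toFun := by
      intro x
      have h1 : ContMDiffAt I I ω (chartAt H x) x :=
        contMDiffAt_of_mem_maximalAtlas (IsManifold.chart_mem_maximalAtlas x)
          (mem_chart_source H x)
      have h2 : ContMDiffAt I I ω (chartAt H (Φ x)).symm (chartAt H x x) :=
        contMDiffAt_symm_of_mem_maximalAtlas (IsManifold.chart_mem_maximalAtlas (Φ x))
          ((chartAt H (Φ x)).map_source (mem_chart_source H (Φ x)))
      refine (h2.comp x h1).congr_of_eventuallyEq ?_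
      filter_upwards [(chartAt H x).open_source.mem_nhds (mem_chart_source H x)] with y hy
      exact ((chartAt H (Φ x)).left_inv hy).symm
    contMDiff_invFun := by
      intro y
      obtain ⟨x, rfl⟩ := Φ.surjective y
      have h1 : ContMDiffAt I I ω (chartAt H (Φ x)) (Φ x) :=
        contMDiffAt_of_mem_maximalAtlas (IsManifold.chart_mem_maximalAtlas (Φ x))
          (mem_chart_source H (Φ x))
      have h2 : ContMDiffAt I I ω (chartAt H x).symm (chartAt H (Φ x) (Φ x)) :=
        contMDiffAt_symm_of_mem_maximalAtlas (IsManifold.chart_mem_maximalAtlas x)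
          ((chartAt H x).map_source (mem_chart_source H x))
      refine (h2.comp (Φ x) h1).congr_of_eventuallyEq ?_
      filter_upwards [(chartAt H (Φ x)).open_source.mem_nhds (mem_chart_source H (Φ x))] with z hz
      exact congrArg Φ.symm ((chartAt H (Φ x)).left_inv hz).symm }

end Transport

/-! ### Orbits as embedded submanifolds -/

theorem trans_mem_maximalAtlas {H M : Type*} [TopologicalSpace H] [TopologicalSpace M]
    [ChartedSpace H M] {G : StructureGroupoid H} {e : OpenPartialHomeomorph M H}
    {f : OpenPartialHomeomorph H H} (he : e ∈ G.maximalAtlas M) (hf : f ∈ G) :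
    e.trans f ∈ G.maximalAtlas M := by
  intro e' he'
  constructor
  · rw [OpenPartialHomeomorph.trans_symm_eq_symm_trans_symm, OpenPartialHomeomorph.trans_assoc]
    exact G.trans (G.symm hf) (he e' he').1
  · rw [← OpenPartialHomeomorph.trans_assoc]
    exact G.trans (he e' he').2 hf

/-- A chart of the quotient is a local section of the covering followed by a chart of the group; `g`
is the lift through which the section passes. -/
theorem exists_chartAt_quotient (K : Subgroup PGL(3, ℂ)) [Finite K] (κ : PGL(3, ℂ) ⧸ K) :
    ∃ g : PGL(3, ℂ), QuotientGroup.mk g = κ ∧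
      chartAt (Fin 8 → ℂ) κ κ = chartAt (Fin 8 → ℂ) g g ∧
      ∀ u, (chartAt (Fin 8 → ℂ) κ).symm u = QuotientGroup.mk ((chartAt (Fin 8 → ℂ) g).symm u) := by
  have hloc := (isQuotientCoveringMap_pgl K).isCoveringMap.isLocalHomeomorph
  have hr := (QuotientGroup.mk_surjective (s := K)).hasRightInverse.choose_spec
  set g := (QuotientGroup.mk_surjective (s := K)).hasRightInverse.choose κ with hg
  refine ⟨g, hr κ, ?_, fun u => ?_⟩
  · have h : chartAt (Fin 8 → ℂ) κ κ = chartAt (Fin 8 → ℂ) g (hloc.localInverseAt g κ) := rfl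
    rw [h]
    refine congrArg _ (Eq.trans ?_ (hloc.localInverseAt_apply_self (x := g)))
    exact congrArg _ (hr κ).symm
  · exact congrFun (hloc.localInverseAt_symm _) _

/-- The orbit of `diagPair l` with its subspace topology is the quotient of `PGL(3, ℂ)` by the
stabilizer. -/
def orbitHomeomorph {l : Fin 3 → ℂ} (hl : Function.Injective l) (hl0 : ∀ a, l a ≠ 0) :
    orbit (diagPair l hl hl0) ≃ₜ
      PGL(3, ℂ) ⧸ MulAction.stabilizer PGL(3, ℂ) (diagPair l hl hl0) :=
  Homeomorph.symm <| Equiv.toHomeomorphOfContinuousOpen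
    (MulAction.orbitEquivQuotientStabilizer PGL(3, ℂ) (diagPair l hl hl0)).symm
    (by
      rw [(QuotientGroup.isQuotientMap_mk _).continuous_iff]
      exact (continuous_smul_pairs _).subtype_mk _)
    (by
      intro U hU
      have h := isOpenMap_orbitMap hl hl0 _ (hU.preimage QuotientGroup.continuous_mk)
      convert h using 1
      ext y
      constructor
      · rintro ⟨κ, hκ, rfl⟩
        obtain ⟨g, rfl⟩ := QuotientGroup.mk_surjective κ
        exact ⟨g, hκ, rfl⟩
      · rintro ⟨g, hg, rfl⟩
        exact ⟨_, hg, rfl⟩)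

theorem orbitHomeomorph_symm_mk {l : Fin 3 → ℂ} (hl : Function.Injective l) (hl0 : ∀ a, l a ≠ 0)
    (g : PGL(3, ℂ)) :
    ((orbitHomeomorph hl hl0).symm (QuotientGroup.mk g) : pairs) = g • diagPair l hl hl0 := rfl

/-- An isomorphism of model spaces. -/
def modelEquiv : ((Fin 8 → ℂ) × (Fin 2 → ℂ)) ≃L[ℂ] ((Fin 5 → ℂ) × (Fin 5 → ℂ)) :=
  ContinuousLinearEquiv.ofFinrankEq (by simp)

/-- Composing the chart of the space of pairs with the inverse of the slice map straightens the
orbit: the inclusion becomes `u ↦ (u, 0)`, with complement the parameters of the transversal. -/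
theorem isSmoothEmbedding_orbit {l : Fin 3 → ℂ} (hl : Function.Injective l) (hl0 : ∀ a, l a ≠ 0)
    [Finite (MulAction.stabilizer PGL(3, ℂ) (diagPair l hl hl0))] :
    letI : ChartedSpace (Fin 8 → ℂ) (orbit (diagPair l hl hl0)) :=
      transportedChartedSpace (orbitHomeomorph hl hl0)
    IsEmbeddedComplexSubmanifold 8 (orbit (diagPair l hl hl0)) := by
  let _ : ChartedSpace (Fin 8 → ℂ) (orbit (diagPair l hl hl0)) :=
    transportedChartedSpace (orbitHomeomorph hl hl0)
  have hM : IsManifold 𝓘(ℂ, Fin 8 → ℂ) ω (orbit (diagPair l hl hl0)) :=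
    isManifold_transported (orbitHomeomorph hl hl0)
  refine ⟨hM, ?_, Topology.IsEmbedding.subtypeVal⟩
  refine Manifold.IsImmersionOfComplement.isImmersion (F := Fin 2 → ℂ) fun x => ?_
  set ψ := chartAt (ModelProd (Fin 5 → ℂ) (Fin 5 → ℂ)) x.1 with hψ
  obtain ⟨g, hg, hgg, hgs⟩ := exists_chartAt_quotient _ (orbitHomeomorph hl hl0 x)
  have hgx : g • diagPair l hl hl0 = x := by
    rw [← orbitHomeomorph_symm_mk, hg, Homeomorph.symm_apply_apply]
  obtain ⟨Θ, h1, h2, h3, h4⟩ := exists_slice hl hl0 g hgx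
  set φ := chartAt (Fin 8 → ℂ) x with hφ
  have hφx : φ x = chartAt (Fin 8 → ℂ) g g := hgg
  have hφs : ∀ u, (φ.symm u : pairs) = (chartAt (Fin 8 → ℂ) g).symm u • diagPair l hl hl0 := by
    intro u
    rw [← orbitHomeomorph_symm_mk, ← hgs]
    rfl
  have hO : IsOpen {u : Fin 8 → ℂ | (u, (0 : Fin 2 → ℂ)) ∈ Θ.source} :=
    Θ.open_source.preimage (Continuous.prodMk_left 0)
  -- `modelEquiv` only brings the values `ℂ⁸ × ℂ²` of the straightened chart back to the model space
  -- `ℂ⁵ × ℂ⁵`.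
  let Γ : OpenPartialHomeomorph ((Fin 5 → ℂ) × (Fin 5 → ℂ)) ((Fin 5 → ℂ) × (Fin 5 → ℂ)) :=
    Θ.symm.transHomeomorph modelEquiv.toHomeomorph
  have hΓ : Γ ∈ contDiffGroupoid ω (𝓘(ℂ, Fin 5 → ℂ).prod 𝓘(ℂ, Fin 5 → ℂ)) := by
    rw [contDiffGroupoid, mem_groupoid_of_pregroupoid]
    have e1 : ContDiffOn ℂ ω Γ Γ.source := modelEquiv.contDiff.comp_contDiffOn h3
    have e2 : ContDiffOn ℂ ω Γ.symm Γ.target :=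
      h2.comp modelEquiv.symm.contDiff.contDiffOn fun y hy => hy
    exact ⟨e1.mono fun y hy => hy.1, e2.mono fun y hy => hy.1⟩
  have key : ∀ u, (u, (0 : Fin 2 → ℂ)) ∈ Θ.source →
      (chartAt (Fin 8 → ℂ) g).symm u • diagPair l hl hl0 ∈ ψ.source ∧
        ψ ((chartAt (Fin 8 → ℂ) g).symm u • diagPair l hl hl0) = Θ (u, 0) := by
    intro u hu
    obtain ⟨-, k1, k2, k3, k4, -⟩ := h4 _ hu
    rw [diagPair_congr (deform_zero l) k1 k2 hl hl0] at k3 k4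
    exact ⟨k3, k4⟩
  -- The chart of the orbit is restricted to the points where `(u, 0)` stays in the source of the
  -- slice map.
  refine Manifold.IsImmersionAtOfComplement.mk_of_continuousAt
    continuous_subtype_val.continuousAt modelEquiv
    (φ.restr (φ.source ∩ φ ⁻¹' {u | (u, (0 : Fin 2 → ℂ)) ∈ Θ.source})) (ψ.trans Γ) ?_ ?_
    (restr_mem_maximalAtlas _ (IsManifold.chart_mem_maximalAtlas x) (φ.isOpen_inter_preimage hO))
    (trans_mem_maximalAtlas (IsManifold.chart_mem_maximalAtlas x.1) hΓ) ?_
  · rw [φ.restr_source' _ (φ.isOpen_inter_preimage hO)]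
    refine ⟨mem_chart_source _ x, mem_chart_source _ x, ?_⟩
    change (φ x, (0 : Fin 2 → ℂ)) ∈ Θ.source
    rw [hφx]
    exact h1
  · refine ⟨mem_chart_source _ x.1, ?_⟩
    obtain ⟨k1, k2⟩ := key _ h1
    have : ψ x.1 = Θ (chartAt (Fin 8 → ℂ) g g, 0) := by
      rw [← k2, (chartAt (Fin 8 → ℂ) g).left_inv (mem_chart_source _ g), hgx]
    change ψ x.1 ∈ Θ.target
    rw [this]
    exact Θ.map_source h1
  · intro u hu
    have hu1 : u ∈ φ.target ∧ φ.symm u ∈ φ.source ∩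
        φ ⁻¹' {u | (u, (0 : Fin 2 → ℂ)) ∈ Θ.source} := by
      have : u ∈ (φ.restr (φ.source ∩ φ ⁻¹' {u | (u, (0 : Fin 2 → ℂ)) ∈ Θ.source})).target := by
        simpa using hu
      rw [OpenPartialHomeomorph.restr_target, (φ.isOpen_inter_preimage hO).interior_eq] at this
      exact this
    have hu2 : (u, (0 : Fin 2 → ℂ)) ∈ Θ.source := by
      have := hu1.2.2
      rwa [Set.mem_preimage, φ.right_inv hu1.1] at this
    change modelEquiv (Θ.symm (ψ (φ.symm u : pairs))) = modelEquiv (u, 0)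
    rw [hφs, (key u hu2).2, Θ.left_inv hu2]

/-! ### Connectedness -/

/-- The determinant is a polynomial in `z` with value `1` at `0`, so it has finitely many roots; the
complement of a countable set in a real plane is path connected. -/
theorem isConnected_setOf_det_ne_zero (M : Matrix (Fin 3) (Fin 3) ℂ) :
    IsConnected {z : ℂ | (1 + z • M).det ≠ 0} := by
  let p : Polynomial ℂ := (1 + (Polynomial.X : Polynomial ℂ) • M.map Polynomial.C).det
  have hp : ∀ z, p.eval z = (1 + z • M).det := fun z => by
    change Polynomial.evalRingHom z p = _
    rw [RingHom.map_det]
    congr 1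
    ext i j
    simp [Matrix.one_apply, apply_ite, mul_comm z]
  have hp0 : p ≠ 0 := by
    intro h
    have := hp 0
    simp [h] at this
  have hfin : {z : ℂ | p.IsRoot z}.Finite := Polynomial.finite_setOfPred_isRoot hp0
  have : {z : ℂ | (1 + z • M).det ≠ 0} = {z : ℂ | p.IsRoot z}ᶜ := by
    ext z
    simp [Polynomial.IsRoot, hp]
  rw [this]
  exact (hfin.countable.isPathConnected_compl_of_one_lt_rank
    (by simp)).isConnected

/-- The complex line through `1` and `A`, without its singular matrices, is connected and joins the
two classes. -/
instance : ConnectedSpace PGL(3, ℂ) := by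
  rw [connectedSpace_iff_univ]
  refine ⟨⟨1, trivial⟩, isPreconnected_of_forall 1 fun y _ => ?_⟩
  induction y using ProjGenLinGroup.induction_on with | mk A => ?_
  have hconn := isConnected_setOf_det_ne_zero (A.1 - 1)
  have : ConnectedSpace {z : ℂ | (1 + z • (A.1 - 1)).det ≠ 0} :=
    isConnected_iff_connectedSpace.1 hconn
  let f : {z : ℂ | (1 + z • (A.1 - 1)).det ≠ 0} → PGL(3, ℂ) := fun z =>
    ProjGenLinGroup.mk (Matrix.GeneralLinearGroup.mkOfDetNeZero _ z.2)
  have hf : Continuous f := by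
    rw [isOpenEmbedding_pglToCP.isInducing.continuous_iff]
    refine (isOpenQuotientMap_mk 8).continuous.comp (Continuous.subtype_mk
      (f := fun z : {z : ℂ | (1 + z • (A.1 - 1)).det ≠ 0} => entries (1 + z.1 • (A.1 - 1))) ?_
      fun z => entries_ne_zero (Matrix.GeneralLinearGroup.mkOfDetNeZero _ z.2))
    exact (LinearMap.continuous_of_finiteDimensional entries.toLinearMap).comp
      (continuous_const.add (continuous_subtype_val.smul continuous_const))
  refine ⟨Set.range f, Set.subset_univ _, ⟨⟨0, by simp⟩, ?_⟩, ⟨⟨1, ?_⟩, ?_⟩,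
    isPreconnected_range hf⟩
  · rw [← map_one ProjGenLinGroup.mk]
    exact congrArg _ (Units.ext (by simp [Matrix.GeneralLinearGroup.mkOfDetNeZero]))
  · simpa using ((Matrix.isUnit_iff_isUnit_det _).1 A.isUnit).ne_zero
  · exact congrArg _ (Units.ext (by simp [Matrix.GeneralLinearGroup.mkOfDetNeZero]))

theorem isConnected_orbit (p : pairs) : IsConnected (orbit p) :=
  isConnected_range (continuous_smul_pairs p)

/-! ### Standard and special orbits -/

theorem exists_charts_diagPair {l : Fin 3 → ℂ} (hl : Function.Injective l) (hl0 : ∀ a, l a ≠ 0)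
    (K : Subgroup PGL(3, ℂ)) [Finite K]
    (hK : MulAction.stabilizer PGL(3, ℂ) (diagPair l hl hl0) = K) :
    ∃ _ : ChartedSpace (Fin 8 → ℂ) (orbit (diagPair l hl hl0)),
      IsEmbeddedComplexSubmanifold 8 (orbit (diagPair l hl hl0)) ∧
      Biholomorphic 8 (orbit (diagPair l hl hl0)) (PGL(3, ℂ) ⧸ K) := by
  -- Substituting, rather than rewriting types, identifies the charts on the quotient by the
  -- stabilizer with those on the quotient by `K`.
  subst hK
  exact ⟨transportedChartedSpace (orbitHomeomorph hl hl0), isSmoothEmbedding_orbit hl hl0,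
    ⟨transportedDiffeomorph (orbitHomeomorph hl hl0)⟩⟩

theorem not_isSpecial_of_orbit_ne {l : Fin 3 → ℂ} (hl : Function.Injective l)
    (hl0 : ∀ a, l a ≠ 0) (h : orbit (diagPair l hl hl0) ≠ orbit specialPair) : ¬ IsSpecial l := by
  intro hs
  obtain ⟨g, hg⟩ := exists_smul_diagPair_eq_specialPair hl hl0 hs
  exact h (MulAction.orbit_eq_iff.2 ⟨g, hg⟩).symm

theorem orbit_ne_of_not_isSpecial {l : Fin 3 → ℂ} (hl : Function.Injective l)
    (hl0 : ∀ a, l a ≠ 0) (h : ¬ IsSpecial l) : orbit (diagPair l hl hl0) ≠ orbit specialPair := by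
  intro ho
  obtain ⟨g, hg⟩ := MulAction.orbit_eq_iff.1 ho.symm
  exact h (isSpecial_of_smul_eq hl hl0 hg)

/-- Both biholomorphism claims are attached to the same charts as the embedding claim, so that one
choice of charts per orbit serves the whole theorem. -/
theorem exists_charts (p : pairs) : ∃ _ : ChartedSpace (Fin 8 → ℂ) (orbit p),
    IsEmbeddedComplexSubmanifold 8 (orbit p) ∧
    (orbit p ≠ orbit specialPair → Biholomorphic 8 (orbit p) (PGL(3, ℂ) ⧸ V4)) ∧
    (orbit p = orbit specialPair → Biholomorphic 8 (orbit p) (PGL(3, ℂ) ⧸ V4Z3)) := by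
  by_cases h : orbit p = orbit specialPair
  · rw [h]
    obtain ⟨c, h1, h2⟩ := exists_charts_diagPair injective_special special_ne_zero V4Z3
      stabilizer_specialPair
    exact ⟨c, h1, fun h' => absurd rfl h', fun _ => h2⟩
  · obtain ⟨g, l, hl, hl0, hg⟩ := exists_smul_eq_diagPair p
    have ho : orbit p = orbit (diagPair l hl hl0) := (MulAction.orbit_eq_iff.2 ⟨g, hg⟩).symm
    rw [ho] at h ⊢
    obtain ⟨c, h1, h2⟩ := exists_charts_diagPair hl hl0 V4
      (stabilizer_eq_V4 hl hl0 (not_isSpecial_of_orbit_ne hl hl0 h))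
    exact ⟨c, h1, fun _ => h2, fun h' => absurd h' h⟩

end

end ConicPairs

theorem mainTheorem6 :
    IsKleinFour V4 ∧ Nat.card Z3 = 3 ∧ Function.Injective semidirectToPGL ∧
    ∃ charts : ∀ p : pairs, ChartedSpace (Fin 8 → ℂ) (orbit p),
      (∀ p : pairs, IsEmbeddedComplexSubmanifold 8 (orbit p) ∧ IsConnected (orbit p)) ∧
      (∀ p : pairs, orbit p ≠ orbit specialPair →
        Biholomorphic 8 (orbit p) (PGL(3, ℂ) ⧸ V4)) ∧
      (∀ (l : Fin 3 → ℂ) (hinj : Function.Injective l) (hl : ∀ i, l i ≠ 0),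
        (¬ ∃ (σ : Equiv.Perm (Fin 3)) (t : ℂ), l ∘ σ = t • ![1, omega, omega ^ 2]) →
        Biholomorphic 8 (orbit (diagPair l hinj hl)) (PGL(3, ℂ) ⧸ V4)) ∧
      Biholomorphic 8 (orbit specialPair) (PGL(3, ℂ) ⧸ V4Z3) := by
  choose charts h1 h2 h3 using exists_charts
  exact ⟨isKleinFour_V4, card_Z3, semidirectToPGL_injective, charts,
    fun p => ⟨h1 p, isConnected_orbit p⟩, h2,
    fun l hinj hl h => h2 _ (orbit_ne_of_not_isSpecial hinj hl h), h3 _ rfl⟩
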